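/- For a permutation $w$ write $l(w)$ for its number of inversions, $t_{ij}$ for the transposition of $i,j$, $s_i=t_{i,i+1}$, and $(wt_{ij})(k)=w(t_{ij}(k))$. Let $S_\infty=\bigcup_n S_n$. Grothendieck polynomials. For $w\in S_n$ the polynomial $\mathfrak G_w\in\mathbb Z[x_1,x_2,\ldots]$ is defined by $\mathfrak G_{w}=x_1^{n-1}x_2^{n-2}\cdots x_{n-1}$ if $w$ is the longest element of $S_n$, and $\mathfrak G_w=\partial_i\big((1-x_{i+1})\,\mathfrak G_{ws_i}\big)$ whenever $w(i)<w(i+1)$, $1\le i<n$, where $\partial_i f=(f-s_if)/(x_i-x_{i+1})$ and $s_i f$ is $f$ with $x_i,x_{i+1}$ interchanged. It depends neither on the choices of $i$ nor on $n$; thus $\mathfrak G_w$ is defined for $w\in S_\infty$. Quadratic algebra. $\mathcal E_n$ is the associative unital $\mathbb Z$-algebra with generators $[ij]$, $1\le i\ne j\le n$, and relations $[ij]+[ji]=0$, $[ij]^2=0$, $[ij][jk]+[jk][ki]+[ki][ij]=0$, $[ij][kl]=[kl][ij]$ for all distinct $i,j,k,l$. For $1\le p\le n$ put $$\kappa_p=1-(1+[p-1,p])(1+[p-2,p])\cdots(1+[1,p])(1+[n,p])(1+[n-1,p])\cdots(1+[p+1,p])\in\mathcal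 E_n.$$ The $\kappa_p$ commute pairwise, so that $\mathfrak G_u(\kappa):=\mathfrak G_u(\kappa_1,\ldots,\kappa_{n-1})$ is defined for $u\in S_n$ (only $x_1,\ldots,x_{n-1}$ occur in $\mathfrak G_u$). Bruhat representation. $\mathcal E_n$ acts on the free abelian group $\mathbb Z\langle S_n\rangle$ with basis $S_n$ by: for $i<j$, $[ij]\,w=wt_{ij}$ if $l(wt_{ij})=l(w)+1$, and $[ij]\,w=0$ otherwise. The factors of a product act from left to right, i.e. $(ab)\,w=b\,(a\,w)$. Corollary. Let $n\ge 0$ and $u,v\in S_n$. There is exactly one family of integers $(c_{uv}^w)_{w\in S_\infty}$, almost all zero, with $$\mathfrak G_u\,\mathfrak G_v=\sum_{w\in S_\infty}c_{uv}^w\,\mathfrak G_w,$$ and for every $w\in S_n$ with $l(w)\ge l(u)+l(v)$ the structure constant $c_{uv}^w$ is equal to the coefficient of $w$ in $\mathfrak G_u(\kappa)\,v$. -/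

import Mathlib

namespace KFlag

open MvPolynomial

/-! ### Permutations -/

/-- The length `l(w)` of `w ∈ S_n`: the number of inversions. Positions are `0, …, n-1`. -/
def length {n : ℕ} (w : Equiv.Perm (Fin n)) : ℕ :=
  (Finset.univ.filter fun p : Fin n × Fin n => p.1 < p.2 ∧ w p.2 < w p.1).card

/-- `S_∞`, the union of all `S_n`: permutations of `ℕ` fixing all sufficiently large numbers. -/
abbrev SInf : Type := {w : Equiv.Perm ℕ // ∃ N : ℕ, ∀ i, N ≤ i → w i = i}

/-- The usual inclusion `S_n ↪ S_∞`. -/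
noncomputable def toSInf {n : ℕ} (w : Equiv.Perm (Fin n)) : SInf :=
  ⟨w.extendDomain Fin.equivSubtype, n, fun _ hi =>
    Equiv.Perm.extendDomain_apply_not_subtype _ _ (not_lt.mpr hi)⟩

/-! ### Grothendieck polynomials

The variable `x_{i+1}` of the usual notation is `X i`. -/

theorem sub_swap_dvd (i : ℕ) (f : MvPolynomial ℕ ℤ) :
    (X i - X (i + 1) : MvPolynomial ℕ ℤ) ∣ f - rename (Equiv.swap i (i + 1)) f := by
  induction f using MvPolynomial.induction_on with
  | C a => simp
  | add p q hp hq =>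
    have : p + q - rename (Equiv.swap i (i + 1)) (p + q)
        = (p - rename (Equiv.swap i (i + 1)) p) + (q - rename (Equiv.swap i (i + 1)) q) := by
      rw [map_add]; ring
    rw [this]
    exact dvd_add hp hq
  | mul_X p j hp =>
    have : p * X j - rename (Equiv.swap i (i + 1)) (p * X j)
        = (p - rename (Equiv.swap i (i + 1)) p) * X j
          + rename (Equiv.swap i (i + 1)) p * (X j - X (Equiv.swap i (i + 1) j)) := by
      rw [map_mul, rename_X]; ring
    rw [this]
    refine dvd_add (dvd_mul_of_dvd_left hp _) (dvd_mul_of_dvd_right ?_ _)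
    by_cases h1 : j = i
    · subst h1; simp
    · by_cases h2 : j = i + 1
      · subst h2
        rw [Equiv.swap_apply_right]
        exact (dvd_sub_comm).mp dvd_rfl
      · rw [Equiv.swap_apply_of_ne_of_ne h1 h2]; simp

/-- The divided difference `(f - s_i f) / (x_i - x_{i+1})`: the unique polynomial `q` with
`f - s_i f = (x_i - x_{i+1}) q`. -/
noncomputable def divDiff (i : ℕ) (f : MvPolynomial ℕ ℤ) : MvPolynomial ℕ ℤ :=
  (sub_swap_dvd i f).choose

theorem divDiff_spec (i : ℕ) (f : MvPolynomial ℕ ℤ) :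
    f - rename (Equiv.swap i (i + 1)) f = (X i - X (i + 1)) * divDiff i f :=
  (sub_swap_dvd i f).choose_spec

/-- The isobaric divided difference `f ↦ ∂_i ((1 - x_{i+1}) f)`. -/
noncomputable def isobaric (i : ℕ) (f : MvPolynomial ℕ ℤ) : MvPolynomial ℕ ℤ :=
  divDiff i ((1 - X (i + 1)) * f)

/-- The pairs of positions below `N` that are not inverted by `w`. -/
def nonInv (N : ℕ) (w : Equiv.Perm ℕ) : Finset (ℕ × ℕ) :=
  (Finset.range N ×ˢ Finset.range N).filter fun p => p.1 < p.2 ∧ w p.1 < w p.2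

theorem card_nonInv_lt {N i : ℕ} {w : Equiv.Perm ℕ} (hN : i + 1 < N) (h : w i < w (i + 1)) :
    (nonInv N (w * Equiv.swap i (i + 1))).card < (nonInv N w).card := by
  have hmem : (i, i + 1) ∈ nonInv N w := by
    simp only [nonInv, Finset.mem_filter, Finset.mem_product, Finset.mem_range]
    exact ⟨⟨by omega, hN⟩, by omega, h⟩
  have hsw : ∀ a, Equiv.swap i (i + 1) a = if a = i then i + 1 else if a = i + 1 then i else a :=
    fun a => Equiv.swap_apply_def i (i + 1) a
  rw [← Finset.card_erase_add_one hmem, Nat.lt_succ_iff]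
  refine Finset.card_le_card_of_injOn
    (fun p => (Equiv.swap i (i + 1) p.1, Equiv.swap i (i + 1) p.2)) ?_ ?_
  · rintro ⟨a, b⟩ hab
    have hab' : (a, b) ∈ nonInv N (w * Equiv.swap i (i + 1)) := hab
    rw [nonInv, Finset.mem_filter, Finset.mem_product, Finset.mem_range, Finset.mem_range,
      Equiv.Perm.mul_apply, Equiv.Perm.mul_apply] at hab'
    obtain ⟨⟨ha, hb⟩, hlt, hw⟩ := hab'
    have hne : ¬ (a = i ∧ b = i + 1) := by
      rintro ⟨rfl, rfl⟩
      rw [Equiv.swap_apply_left, Equiv.swap_apply_right] at hw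
      omega
    simp only [nonInv, Finset.coe_erase, Set.mem_sdiff, Finset.mem_coe, Finset.mem_filter,
      Finset.mem_product, Finset.mem_range, Set.mem_singleton_iff, Prod.mk.injEq]
    refine ⟨⟨⟨?_, ?_⟩, ?_, hw⟩, ?_⟩
    · rw [hsw]; split_ifs <;> omega
    · rw [hsw]; split_ifs <;> omega
    · rw [hsw, hsw]; split_ifs <;> omega
    · rw [hsw, hsw]; split_ifs <;> omega
  · rintro ⟨a, b⟩ - ⟨c, d⟩ - h
    simpa using h

/-- For `w` permuting `{0, …, N-1}` (and fixing the rest), the Grothendieck polynomial of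
`w ∈ S_N`: it is `x_1^{N-1} x_2^{N-2} ⋯ x_{N-1}` for the longest element of `S_N`, and
`𝔊_w = ∂_i ((1 - x_{i+1}) 𝔊_{w s_i})` if `w(i) < w(i+1)` (the first such `i` is used). -/
noncomputable def grothendieckAux (N : ℕ) (w : Equiv.Perm ℕ) : MvPolynomial ℕ ℤ :=
  open Classical in
  if h : ∃ i, i + 1 < N ∧ w i < w (i + 1) then
    isobaric (Nat.find h) (grothendieckAux N (w * Equiv.swap (Nat.find h) (Nat.find h + 1)))
  else ∏ i ∈ Finset.range N, X i ^ (N - 1 - i)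
termination_by (nonInv N w).card
decreasing_by
  exact card_nonInv_lt (Nat.find_spec h).1 (Nat.find_spec h).2

/-- The Grothendieck polynomial `𝔊_w(x)` for `w ∈ S_∞`, computed in the smallest `S_N` that
contains `w`. -/
noncomputable def grothendieck (w : SInf) : MvPolynomial ℕ ℤ :=
  open Classical in grothendieckAux (Nat.find w.2) w.1

/-- `c` is a family of structure constants for `𝔊_u 𝔊_v`: the integers `c w`, `w ∈ S_∞`, almost
all zero, satisfy `𝔊_u 𝔊_v = ∑_w c_w 𝔊_w`. -/
def IsStructureConstants (u v : SInf) (c : SInf →₀ ℤ) : Prop :=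
  grothendieck u * grothendieck v = c.sum fun w a => a • grothendieck w

/-! ### The quadratic algebra -/

/-- Index set of the generators `[ij]`, `i ≠ j`. -/
abbrev Gen (n : ℕ) : Type := {p : Fin n × Fin n // p.1 ≠ p.2}

/-- The generator `[ij]` in the free associative algebra. -/
def freeGen {n : ℕ} (i j : Fin n) (h : i ≠ j) : FreeAlgebra ℤ (Gen n) :=
  FreeAlgebra.ι ℤ ⟨(i, j), h⟩

/-- The defining relations of the quadratic algebra `ℰ_n`. -/
inductive Rel (n : ℕ) : FreeAlgebra ℤ (Gen n) → FreeAlgebra ℤ (Gen n) → Prop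
  | antisymm (i j : Fin n) (h : i ≠ j) : Rel n (freeGen i j h + freeGen j i h.symm) 0
  | square (i j : Fin n) (h : i ≠ j) : Rel n (freeGen i j h * freeGen i j h) 0
  | triangle (i j k : Fin n) (hij : i ≠ j) (hjk : j ≠ k) (hki : k ≠ i) :
      Rel n (freeGen i j hij * freeGen j k hjk + freeGen j k hjk * freeGen k i hki
        + freeGen k i hki * freeGen i j hij) 0
  | comm (i j k l : Fin n) (hij : i ≠ j) (hkl : k ≠ l)
      (hik : i ≠ k) (hil : i ≠ l) (hjk : j ≠ k) (hjl : j ≠ l) :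
      Rel n (freeGen i j hij * freeGen k l hkl) (freeGen k l hkl * freeGen i j hij)

/-- The quadratic algebra `ℰ_n`. -/
abbrev QuadAlg (n : ℕ) : Type := RingQuot (Rel n)

/-- The element `[ij]` of `ℰ_n` (set to `0` in the unused case `i = j`). -/
noncomputable def bracket {n : ℕ} (i j : Fin n) : QuadAlg n :=
  if h : i ≠ j then RingQuot.mkAlgHom ℤ (Rel n) (freeGen i j h) else 0

/-- The `K`-theoretic Dunkl element
`κ_p = 1 - (1+[p-1,p])(1+[p-2,p])⋯(1+[1,p])(1+[n,p])(1+[n-1,p])⋯(1+[p+1,p])`. -/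
noncomputable def kappa {n : ℕ} (p : Fin n) : QuadAlg n :=
  1 - ((((List.finRange n).filter (· < p)).reverse ++
      ((List.finRange n).filter (p < ·)).reverse).map fun i => 1 + bracket i p).prod

/-- The value `f(a_0, a_1, …)` of a polynomial at elements of a possibly noncommutative ring; the
factors of each monomial are multiplied by increasing index (when the `a_i` commute, the order does
not matter). -/
noncomputable def evalAt {A : Type*} [Ring A] (a : ℕ → A) (f : MvPolynomial ℕ ℤ) : A :=
  ∑ m ∈ f.support, f.coeff m • ((m.support.sort (· ≤ ·)).map fun i => a i ^ m i).prod

/-- `f(κ_1, …, κ_{n-1})` for a polynomial `f` in `x_1, …, x_{n-1}` (any further variable is sent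
to `0`; none occurs in `𝔊_w` with `w ∈ S_n`). -/
noncomputable def evalKappa (n : ℕ) (f : MvPolynomial ℕ ℤ) : QuadAlg n :=
  evalAt (fun i => if h : i + 1 < n then kappa ⟨i, Nat.lt_of_succ_lt h⟩ else 0) f

/-! ### The Bruhat representation -/

/-- The free abelian group `ℤ⟨S_n⟩` on `S_n`. -/
abbrev ZS (n : ℕ) : Type := Equiv.Perm (Fin n) →₀ ℤ

/-- The operator of `[ij]`, `i < j`: it maps `w` to `w t_{ij}` if `l(w t_{ij}) = l(w) + 1`, and
to `0` otherwise. -/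
noncomputable def coverOp {n : ℕ} (i j : Fin n) : ZS n →ₗ[ℤ] ZS n :=
  Finsupp.linearCombination ℤ fun w : Equiv.Perm (Fin n) =>
    if length (w * Equiv.swap i j) = length w + 1 then
      Finsupp.single (w * Equiv.swap i j) (1 : ℤ) else 0

/-- The operator of an arbitrary generator, using `[ij] = -[ji]`. -/
noncomputable def bruhatOp {n : ℕ} (i j : Fin n) : ZS n →ₗ[ℤ] ZS n :=
  if i < j then coverOp i j else - coverOp j i

/-- Covering relations of the Bruhat order, in terms of positions and values. -/
def Cov {n : ℕ} (w : Equiv.Perm (Fin n)) (i j : Fin n) : Prop :=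
  w i < w j ∧ ∀ m, i < m → m < j → ¬ (w i < w m ∧ w m < w j)

theorem sum_pairs_split {n : ℕ} {i j : Fin n} (hij : i ≠ j) (g : Fin n → Fin n → ℤ) :
    ∑ a, ∑ b, g a b =
      (∑ a ∈ (Finset.univ.erase i).erase j, ∑ b ∈ (Finset.univ.erase i).erase j, g a b)
      + (∑ m ∈ (Finset.univ.erase i).erase j, (g m i + g i m + g m j + g j m))
      + (g i i + g i j + g j i + g j j) := by
  have hs : ∀ f : Fin n → ℤ,
      ∑ a, f a = (∑ a ∈ (Finset.univ.erase i).erase j, f a) + f j + f i := by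
    intro f
    rw [Finset.sum_erase_add _ _ (by simp [hij.symm]), Finset.sum_erase_add _ _ (by simp)]
  simp only [hs, Finset.sum_add_distrib]
  ring

theorem length_eq_sum {n : ℕ} (w : Equiv.Perm (Fin n)) :
    (length w : ℤ) = ∑ a, ∑ b, if a < b ∧ w b < w a then (1 : ℤ) else 0 := by
  rw [length, Finset.card_filter, Fintype.sum_prod_type]
  push_cast
  rfl

theorem length_mul_swap {n : ℕ} (w : Equiv.Perm (Fin n)) {i j : Fin n} (hij : i < j)
    (hw : w i < w j) :
    (length (w * Equiv.swap i j) : ℤ) = length w + 1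
      + 2 * ∑ m ∈ (Finset.univ.erase i).erase j,
          if i < m ∧ m < j ∧ w i < w m ∧ w m < w j then (1 : ℤ) else 0 := by
  have hsw : ∀ a, a ≠ i → a ≠ j → (w * Equiv.swap i j) a = w a := fun a h1 h2 => by
    rw [Equiv.Perm.mul_apply, Equiv.swap_apply_of_ne_of_ne h1 h2]
  have hi : (w * Equiv.swap i j) i = w j := by simp
  have hj : (w * Equiv.swap i j) j = w i := by simp
  rw [length_eq_sum, length_eq_sum, sum_pairs_split hij.ne, sum_pairs_split hij.ne, hi, hj]
  have h1 : (∑ a ∈ (Finset.univ.erase i).erase j, ∑ b ∈ (Finset.univ.erase i).erase j,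
        if a < b ∧ (w * Equiv.swap i j) b < (w * Equiv.swap i j) a then (1 : ℤ) else 0)
      = ∑ a ∈ (Finset.univ.erase i).erase j, ∑ b ∈ (Finset.univ.erase i).erase j,
        if a < b ∧ w b < w a then (1 : ℤ) else 0 := by
    refine Finset.sum_congr rfl fun a ha => Finset.sum_congr rfl fun b hb => ?_
    simp only [Finset.mem_erase, Finset.mem_univ, and_true] at ha hb
    rw [hsw a ha.2 ha.1, hsw b hb.2 hb.1]
  rw [h1]
  have h2 : (∑ m ∈ (Finset.univ.erase i).erase j,
        ((if m < i ∧ w j < (w * Equiv.swap i j) m then (1 : ℤ) else 0)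
        + (if i < m ∧ (w * Equiv.swap i j) m < w j then 1 else 0)
        + (if m < j ∧ w i < (w * Equiv.swap i j) m then 1 else 0)
        + (if j < m ∧ (w * Equiv.swap i j) m < w i then 1 else 0)))
      = (∑ m ∈ (Finset.univ.erase i).erase j,
        ((if m < i ∧ w i < w m then (1 : ℤ) else 0) + (if i < m ∧ w m < w i then 1 else 0)
        + (if m < j ∧ w j < w m then 1 else 0) + (if j < m ∧ w m < w j then 1 else 0)))
      + 2 * ∑ m ∈ (Finset.univ.erase i).erase j,
          if i < m ∧ m < j ∧ w i < w m ∧ w m < w j then (1 : ℤ) else 0 := by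
    rw [Finset.mul_sum, ← Finset.sum_add_distrib]
    refine Finset.sum_congr rfl fun m hm => ?_
    simp only [Finset.mem_erase, Finset.mem_univ, and_true] at hm
    rw [hsw m hm.2 hm.1]
    have e1 : w m ≠ w i := fun h => hm.2 (w.injective h)
    have e2 : w m ≠ w j := fun h => hm.1 (w.injective h)
    rcases lt_or_gt_of_ne hm.2 with a1 | a1 <;> rcases lt_or_gt_of_ne hm.1 with a2 | a2 <;>
      rcases lt_or_gt_of_ne e1 with a3 | a3 <;> rcases lt_or_gt_of_ne e2 with a4 | a4 <;>
      first
        | exact absurd (a1.trans hij) a2.asymm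
        | exact absurd (a3.trans hw) a4.asymm
        | simp [a1, a2, a3, a4, a1.asymm, a2.asymm, a3.asymm, a4.asymm]
  rw [h2]
  simp [hij, hw, hij.asymm, hw.asymm]
  ring

theorem length_swap_iff {n : ℕ} (w : Equiv.Perm (Fin n)) {i j : Fin n} (hij : i < j) :
    length (w * Equiv.swap i j) = length w + 1 ↔ Cov w i j := by
  have hnn : ∀ w' : Equiv.Perm (Fin n), 0 ≤ ∑ m ∈ (Finset.univ.erase i).erase j,
      if i < m ∧ m < j ∧ w' i < w' m ∧ w' m < w' j then (1 : ℤ) else 0 := fun w' =>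
    Finset.sum_nonneg fun m _ => by split_ifs <;> simp
  rcases lt_or_gt_of_ne (fun h => hij.ne (w.injective h) : w i ≠ w j) with hw | hw
  · have key := length_mul_swap w hij hw
    have h0 : length (w * Equiv.swap i j) = length w + 1 ↔
        (∑ m ∈ (Finset.univ.erase i).erase j,
          if i < m ∧ m < j ∧ w i < w m ∧ w m < w j then (1 : ℤ) else 0) = 0 := by omega
    rw [h0, Finset.sum_eq_zero_iff_of_nonneg (fun m _ => by split_ifs <;> simp)]
    simp only [Finset.mem_erase, Finset.mem_univ, and_true, ite_eq_right_iff, one_ne_zero,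
      imp_false, Cov]
    constructor
    · intro h
      exact ⟨hw, fun m h1 h2 h3 => h m ⟨h2.ne, h1.ne'⟩ ⟨h1, h2, h3⟩⟩
    · rintro ⟨-, h⟩ m - ⟨h1, h2, h3⟩
      exact h m h1 h2 h3
  · have key := length_mul_swap (w * Equiv.swap i j) hij (by simpa using hw)
    have := hnn (w * Equiv.swap i j)
    rw [mul_assoc, Equiv.swap_mul_self, mul_one] at key
    constructor
    · intro h; omega
    · intro h; exact absurd h.1 hw.asymm

open Classical in
/-- The coefficient of `w t_{ij}` in `[ij] w`. -/
noncomputable def sgnCov {n : ℕ} (w : Equiv.Perm (Fin n)) (i j : Fin n) : ℤ :=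
  if i < j then (if Cov w i j then 1 else 0) else -(if Cov w j i then 1 else 0)

theorem bruhatOp_single {n : ℕ} (w : Equiv.Perm (Fin n)) (i j : Fin n) (h : i ≠ j) :
    bruhatOp i j (Finsupp.single w 1) =
      sgnCov w i j • Finsupp.single (w * Equiv.swap i j) 1 := by
  rcases lt_or_gt_of_ne h with h | h
  · rw [bruhatOp, if_pos h, coverOp, Finsupp.linearCombination_single, one_smul, sgnCov, if_pos h]
    have hl := length_swap_iff w h
    by_cases hc : Cov w i j
    · simp [hc, hl.mpr hc]
    · simp [hc, mt hl.mp hc]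
  · rw [bruhatOp, if_neg h.asymm, LinearMap.neg_apply, coverOp, Finsupp.linearCombination_single,
      one_smul, sgnCov, if_neg h.asymm, Equiv.swap_comm i j]
    have hl := length_swap_iff w h
    by_cases hc : Cov w j i
    · simp [hc, hl.mpr hc]
    · simp [hc, mt hl.mp hc]

theorem sgnCov_antisymm {n : ℕ} (w : Equiv.Perm (Fin n)) (i j : Fin n) (h : i ≠ j) :
    sgnCov w i j = - sgnCov w j i := by
  rcases lt_or_gt_of_ne h with h | h <;> simp [sgnCov, h, h.asymm]

theorem bruhat_antisymm {n : ℕ} (i j : Fin n) (h : i ≠ j) :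
    bruhatOp i j + bruhatOp j i = 0 := by
  rcases lt_or_gt_of_ne h with h | h <;> simp [bruhatOp, h, h.asymm]

theorem bruhat_comp_single {n : ℕ} (w : Equiv.Perm (Fin n)) (i j k l : Fin n) (hij : i ≠ j)
    (hkl : k ≠ l) :
    (bruhatOp k l ∘ₗ bruhatOp i j) (Finsupp.single w 1) =
      (sgnCov w i j * sgnCov (w * Equiv.swap i j) k l) •
        Finsupp.single (w * (Equiv.swap i j * Equiv.swap k l)) 1 := by
  rw [LinearMap.comp_apply, bruhatOp_single w i j hij, map_smul, bruhatOp_single _ k l hkl,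
    smul_smul, mul_assoc]

theorem bruhat_square {n : ℕ} (i j : Fin n) (h : i ≠ j) :
    bruhatOp i j ∘ₗ bruhatOp i j = 0 := by
  refine Finsupp.lhom_ext' fun w => LinearMap.ext_ring ?_
  change (bruhatOp i j ∘ₗ bruhatOp i j) (Finsupp.single w 1) = 0
  rw [bruhat_comp_single w i j i j h h]
  suffices sgnCov w i j * sgnCov (w * Equiv.swap i j) i j = 0 by rw [this, zero_smul]
  simp only [sgnCov, Cov]
  grind [Equiv.Perm.mul_apply, Equiv.swap_apply_left, Equiv.swap_apply_right]

theorem swap_vals {n : ℕ} (w : Equiv.Perm (Fin n)) (i j : Fin n) :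
    (w * Equiv.swap i j) i = w j ∧ (w * Equiv.swap i j) j = w i ∧
      ∀ m, m ≠ i → m ≠ j → (w * Equiv.swap i j) m = w m := by
  refine ⟨by simp, by simp, fun m h1 h2 => ?_⟩
  rw [Equiv.Perm.mul_apply, Equiv.swap_apply_of_ne_of_ne h1 h2]

theorem cov_triangle {n : ℕ} (w : Equiv.Perm (Fin n)) {i j k : Fin n} (hij : i < j) (hjk : j < k) :
    ((Cov w i j ∧ Cov (w * Equiv.swap i j) j k) ↔
      (Cov w j k ∧ Cov (w * Equiv.swap j k) i k) ∨ (Cov w i k ∧ Cov (w * Equiv.swap i k) i j)) ∧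
    ¬ ((Cov w j k ∧ Cov (w * Equiv.swap j k) i k) ∧
      (Cov w i k ∧ Cov (w * Equiv.swap i k) i j)) := by
  obtain ⟨a1, a2, a3⟩ := swap_vals w i j
  obtain ⟨b1, b2, b3⟩ := swap_vals w j k
  obtain ⟨c1, c2, c3⟩ := swap_vals w i k
  have inj : ∀ x y, x ≠ y → w x ≠ w y := fun x y h1 h2 => h1 (w.injective h2)
  unfold Cov
  generalize (w * Equiv.swap i j) = w1 at *
  generalize (w * Equiv.swap j k) = w2 at *
  generalize (w * Equiv.swap i k) = w3 at *
  grind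

theorem cov_triangle' {n : ℕ} (w : Equiv.Perm (Fin n)) {i j k : Fin n} (hij : i < j)
    (hjk : j < k) :
    ((Cov w j k ∧ Cov (w * Equiv.swap j k) i j) ↔
      (Cov w i j ∧ Cov (w * Equiv.swap i j) i k) ∨ (Cov w i k ∧ Cov (w * Equiv.swap i k) j k)) ∧
    ¬ ((Cov w i j ∧ Cov (w * Equiv.swap i j) i k) ∧
      (Cov w i k ∧ Cov (w * Equiv.swap i k) j k)) := by
  obtain ⟨a1, a2, a3⟩ := swap_vals w i j
  obtain ⟨b1, b2, b3⟩ := swap_vals w j k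
  obtain ⟨c1, c2, c3⟩ := swap_vals w i k
  have inj : ∀ x y, x ≠ y → w x ≠ w y := fun x y h1 h2 => h1 (w.injective h2)
  unfold Cov
  generalize (w * Equiv.swap i j) = w1 at *
  generalize (w * Equiv.swap j k) = w2 at *
  generalize (w * Equiv.swap i k) = w3 at *
  grind

theorem cov_comm {n : ℕ} (w : Equiv.Perm (Fin n)) {i j k l : Fin n} (hij : i < j) (hkl : k < l)
    (hik : i ≠ k) (hil : i ≠ l) (hjk : j ≠ k) (hjl : j ≠ l)
    (h : Cov w i j ∧ Cov (w * Equiv.swap i j) k l) :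
    Cov w k l ∧ Cov (w * Equiv.swap k l) i j := by
  obtain ⟨a1, a2, a3⟩ := swap_vals w i j
  obtain ⟨b1, b2, b3⟩ := swap_vals w k l
  have inj : ∀ x y, x ≠ y → w x ≠ w y := fun x y h1 h2 => h1 (w.injective h2)
  have n1 := inj _ _ hik
  have n2 := inj _ _ hil
  have n3 := inj _ _ hjk
  have n4 := inj _ _ hjl
  clear inj
  unfold Cov at *
  generalize (w * Equiv.swap i j) = w1 at *
  generalize (w * Equiv.swap k l) = w2 at *
  grind

theorem sgn_triangle {n : ℕ} (w : Equiv.Perm (Fin n)) {i j k : Fin n} (hij : i < j)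
    (hjk : j < k) :
    sgnCov w i j * sgnCov (w * Equiv.swap i j) j k
      + sgnCov w j k * sgnCov (w * Equiv.swap j k) k i
      + sgnCov w k i * sgnCov (w * Equiv.swap k i) i j = 0 := by
  obtain ⟨h1, h2⟩ := cov_triangle w hij hjk
  have hik := hij.trans hjk
  rw [Equiv.swap_comm k i]
  simp only [sgnCov, if_pos hij, if_pos hjk, if_neg hik.asymm]
  grind

theorem sgn_triangle' {n : ℕ} (w : Equiv.Perm (Fin n)) {i j k : Fin n} (hij : i < j)
    (hjk : j < k) :
    sgnCov w k j * sgnCov (w * Equiv.swap k j) j i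
      + sgnCov w j i * sgnCov (w * Equiv.swap j i) i k
      + sgnCov w i k * sgnCov (w * Equiv.swap i k) k j = 0 := by
  obtain ⟨h1, h2⟩ := cov_triangle' w hij hjk
  have hik := hij.trans hjk
  rw [Equiv.swap_comm k j, Equiv.swap_comm j i]
  simp only [sgnCov, if_pos hik, if_neg hij.asymm, if_neg hjk.asymm]
  grind

theorem bruhat_triangle {n : ℕ} (i j k : Fin n) (hij : i ≠ j) (hjk : j ≠ k) (hki : k ≠ i) :
    bruhatOp j k ∘ₗ bruhatOp i j + bruhatOp k i ∘ₗ bruhatOp j k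
      + bruhatOp i j ∘ₗ bruhatOp k i = 0 := by
  refine Finsupp.lhom_ext' fun w => LinearMap.ext_ring ?_
  change (bruhatOp j k ∘ₗ bruhatOp i j) (Finsupp.single w 1)
    + (bruhatOp k i ∘ₗ bruhatOp j k) (Finsupp.single w 1)
    + (bruhatOp i j ∘ₗ bruhatOp k i) (Finsupp.single w 1) = 0
  rw [bruhat_comp_single w i j j k hij hjk, bruhat_comp_single w j k k i hjk hki,
    bruhat_comp_single w k i i j hki hij]
  have e1 : Equiv.swap j k * Equiv.swap k i = Equiv.swap i j * Equiv.swap j k := by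
    ext x; simp only [Equiv.Perm.mul_apply, Equiv.swap_apply_def]; grind
  have e2 : Equiv.swap k i * Equiv.swap i j = Equiv.swap i j * Equiv.swap j k := by
    ext x; simp only [Equiv.Perm.mul_apply, Equiv.swap_apply_def]; grind
  rw [e1, e2, ← add_smul, ← add_smul]
  suffices h : sgnCov w i j * sgnCov (w * Equiv.swap i j) j k
      + sgnCov w j k * sgnCov (w * Equiv.swap j k) k i
      + sgnCov w k i * sgnCov (w * Equiv.swap k i) i j = 0 by rw [h, zero_smul]
  rcases lt_or_gt_of_ne hij with a | a <;> rcases lt_or_gt_of_ne hjk with b | b <;>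
    rcases lt_or_gt_of_ne hki with c | c
  · exact absurd (a.trans b) c.asymm
  · exact sgn_triangle w a b
  · linarith [sgn_triangle w c a]
  · linarith [sgn_triangle' w c b]
  · linarith [sgn_triangle w b c]
  · linarith [sgn_triangle' w a c]
  · linarith [sgn_triangle' w b a]
  · exact absurd (b.trans a) c.asymm

theorem bruhat_comm {n : ℕ} (i j k l : Fin n) (hij : i ≠ j) (hkl : k ≠ l)
    (hik : i ≠ k) (hil : i ≠ l) (hjk : j ≠ k) (hjl : j ≠ l) :
    bruhatOp k l ∘ₗ bruhatOp i j = bruhatOp i j ∘ₗ bruhatOp k l := by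
  refine Finsupp.lhom_ext' fun w => LinearMap.ext_ring ?_
  change (bruhatOp k l ∘ₗ bruhatOp i j) (Finsupp.single w 1)
    = (bruhatOp i j ∘ₗ bruhatOp k l) (Finsupp.single w 1)
  rw [bruhat_comp_single w i j k l hij hkl, bruhat_comp_single w k l i j hkl hij]
  have e1 : Equiv.swap k l * Equiv.swap i j = Equiv.swap i j * Equiv.swap k l := by
    ext x; simp only [Equiv.Perm.mul_apply, Equiv.swap_apply_def]; grind
  rw [e1]
  congr 1
  have key : ∀ {a b c d : Fin n}, a < b → c < d → a ≠ c → a ≠ d → b ≠ c → b ≠ d →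
      sgnCov w a b * sgnCov (w * Equiv.swap a b) c d
        = sgnCov w c d * sgnCov (w * Equiv.swap c d) a b := by
    intro a b c d hab hcd h1 h2 h3 h4
    have p := cov_comm w hab hcd h1 h2 h3 h4
    have q := cov_comm w hcd hab h1.symm h3.symm h2.symm h4.symm
    simp only [sgnCov, if_pos hab, if_pos hcd]
    grind
  rcases lt_or_gt_of_ne hij with a | a <;> rcases lt_or_gt_of_ne hkl with b | b
  · exact key a b hik hil hjk hjl
  · rw [sgnCov_antisymm _ k l hkl, sgnCov_antisymm w k l hkl, Equiv.swap_comm k l]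
    linarith [key a b hil hik hjl hjk]
  · rw [sgnCov_antisymm w i j hij, sgnCov_antisymm _ i j hij, Equiv.swap_comm i j]
    linarith [key a b hjk hjl hik hil]
  · rw [sgnCov_antisymm w i j hij, sgnCov_antisymm _ i j hij, sgnCov_antisymm _ k l hkl,
      sgnCov_antisymm w k l hkl, Equiv.swap_comm i j, Equiv.swap_comm k l]
    linarith [key a b hjl hjk hil hik]

open MulOpposite in
/-- The Bruhat representation of `ℰ_n` on `ℤ⟨S_n⟩`. A monomial `[ij][kl]⋯` acts by applying first
`[ij]`, then `[kl]`, and so on: the target is the opposite of the endomorphism ring. -/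
noncomputable def bruhat (n : ℕ) : QuadAlg n →ₐ[ℤ] (Module.End ℤ (ZS n))ᵐᵒᵖ :=
  RingQuot.liftAlgHom ℤ (s := Rel n)
    ⟨FreeAlgebra.lift ℤ fun p : Gen n => op (bruhatOp p.1.1 p.1.2), by
      intro x y h
      cases h with
      | antisymm i j h =>
        simp only [freeGen, map_add, map_zero, FreeAlgebra.lift_ι_apply, ← op_add,
          bruhat_antisymm i j h, op_zero]
      | square i j h =>
        simp only [freeGen, map_mul, map_zero, FreeAlgebra.lift_ι_apply, ← op_mul,
          Module.End.mul_eq_comp, bruhat_square i j h, op_zero]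
      | triangle i j k hij hjk hki =>
        simp only [freeGen, map_add, map_mul, map_zero, FreeAlgebra.lift_ι_apply, ← op_mul,
          ← op_add, Module.End.mul_eq_comp, bruhat_triangle i j k hij hjk hki, op_zero]
      | comm i j k l hij hkl hik hil hjk hjl =>
        simp only [freeGen, map_mul, FreeAlgebra.lift_ι_apply, ← op_mul,
          Module.End.mul_eq_comp, bruhat_comm i j k l hij hkl hik hil hjk hjl]⟩

/-- `e v`, the result of acting with `e ∈ ℰ_n` on `v ∈ S_n ⊆ ℤ⟨S_n⟩`. -/
noncomputable def bruhatAct {n : ℕ} (e : QuadAlg n) (v : Equiv.Perm (Fin n)) : ZS n :=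
  (bruhat n e).unop (Finsupp.single v 1)

end KFlag

namespace KFlag

open MvPolynomial

/-! ### Isobaric divided differences -/

/-! Write `π_i` for the isobaric divided difference `isobaric i`. The theorem amounts to this: if
polynomials are expanded in the basis of Grothendieck polynomials and all terms outside `S_n` are
dropped (`expansion n`), then multiplication by `x_p` becomes the operator of `κ_p`
(`expansion_X_mul`). Applying this variable by variable to `𝔊_u · 𝔊_v` gives `𝔊_u(κ) v`, starting
from the basis vector `v`, the image of `𝔊_v`.

Both the basis property and the formula for `x_p` rest on a rigidity principle
(`eq_zero_of_stable`). On basis elements `π_i` acts by `w ↦ w s_i` if `i` is a descent of `w`, and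
by `w ↦ w` otherwise. Removing descents connects every `w` to the identity. Hence a set of vectors
that is stable under these operators, and on which the coefficient of the identity vanishes,
contains no nonzero vector.

Basis: the constant term of a combination of Grothendieck polynomials is its coefficient at the
identity, and the kernel of `grothendieckLin` is stable, so the polynomials are independent. They
span because their span contains `1` and is closed under multiplication by each `1 - x_p`: this
factor can be moved past `π_i`, which reduces the claim to staircase monomials.

Multiplication by `x_p`: the operator of `1 - κ_p` obeys the same rules with respect to the Demazure
operators on `ℤ⟨S_n⟩` as multiplication by `1 - x_p` does with respect to `π_i`
(`dunklOp_left_mul_demOp`, `dunklOp_right_mul_demOp`, `dunklOp_mul_demOp_of_ne`). Therefore the span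
of all differences `dunklDefect` is stable. Neither operation changes the coefficient of the
identity, so rigidity makes the differences vanish. -/

/-- The involution of the polynomial ring that interchanges `X i` and `X (i + 1)`. -/
noncomputable abbrev refl (i : ℕ) : MvPolynomial ℕ ℤ →ₐ[ℤ] MvPolynomial ℕ ℤ :=
  rename (Equiv.swap i (i + 1))

theorem refl_X_left (i : ℕ) : refl i (X i) = X (i + 1) := by
  rw [rename_X, Equiv.swap_apply_left]

theorem refl_X_right (i : ℕ) : refl i (X (i + 1)) = X i := by
  rw [rename_X, Equiv.swap_apply_right]

theorem refl_X_of_ne {i j : ℕ} (h : j ≠ i) (h' : j ≠ i + 1) : refl i (X j) = X j := by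
  rw [rename_X, Equiv.swap_apply_of_ne_of_ne h h']

theorem refl_refl (i : ℕ) (f : MvPolynomial ℕ ℤ) : refl i (refl i f) = f := by
  rw [rename_rename, ← Equiv.coe_trans, ← Equiv.Perm.mul_def, Equiv.swap_mul_self]
  exact rename_id_apply f

theorem refl_comm {i j : ℕ} (h : i + 1 < j) (f : MvPolynomial ℕ ℤ) :
    refl i (refl j f) = refl j (refl i f) := by
  rw [rename_rename, rename_rename]
  congr 2
  funext k
  simp only [Function.comp, Equiv.swap_apply_def]
  grind

theorem refl_braid (i : ℕ) (f : MvPolynomial ℕ ℤ) :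
    refl i (refl (i + 1) (refl i f)) = refl (i + 1) (refl i (refl (i + 1) f)) := by
  simp only [rename_rename]
  congr 2
  funext k
  simp only [Function.comp, Equiv.swap_apply_def]
  grind

theorem X_sub_X_ne_zero {i j : ℕ} (h : i ≠ j) : (X i - X j : MvPolynomial ℕ ℤ) ≠ 0 :=
  sub_ne_zero.mpr fun e => h (X_injective e)

theorem isobaric_spec (i : ℕ) (f : MvPolynomial ℕ ℤ) :
    (X i - X (i + 1)) * isobaric i f = (1 - X (i + 1)) * f - (1 - X i) * refl i f := by
  rw [isobaric, ← divDiff_spec, map_mul, map_sub, map_one, refl_X_right]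

theorem isobaric_eq {i : ℕ} {f q : MvPolynomial ℕ ℤ}
    (h : (X i - X (i + 1)) * q = (1 - X (i + 1)) * f - (1 - X i) * refl i f) :
    isobaric i f = q :=
  mul_left_cancel₀ (X_sub_X_ne_zero (Nat.lt_succ_self i).ne) ((isobaric_spec i f).trans h.symm)

/-- The isobaric divided difference as a linear map. -/
noncomputable def isobaricLin (i : ℕ) : MvPolynomial ℕ ℤ →ₗ[ℤ] MvPolynomial ℕ ℤ where
  toFun := isobaric i
  map_add' f g := isobaric_eq <| by
    rw [mul_add, isobaric_spec, isobaric_spec, map_add]; ring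
  map_smul' a f := isobaric_eq <| by
    rw [RingHom.id_apply, mul_smul_comm, isobaric_spec, map_smul, smul_sub, mul_smul_comm,
      mul_smul_comm]

theorem isobaricLin_apply (i : ℕ) (f : MvPolynomial ℕ ℤ) : isobaricLin i f = isobaric i f := rfl

theorem isobaric_mul_of_refl_eq {i : ℕ} {g : MvPolynomial ℕ ℤ} (hg : refl i g = g)
    (f : MvPolynomial ℕ ℤ) : isobaric i (g * f) = g * isobaric i f :=
  isobaric_eq <| by
    rw [map_mul, hg]
    linear_combination g * isobaric_spec i f

theorem isobaric_X_mul_of_refl_eq {i : ℕ} {g : MvPolynomial ℕ ℤ} (hg : refl i g = g) :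
    isobaric i (X i * g) = g :=
  isobaric_eq <| by
    rw [map_mul, hg, refl_X_left]
    ring

/-- Interchanging the two variables changes the sign of both sides of `isobaric_spec`. -/
theorem refl_isobaric (i : ℕ) (f : MvPolynomial ℕ ℤ) : refl i (isobaric i f) = isobaric i f := by
  have h := isobaric_spec i f
  have h' := congrArg (refl i) h
  simp only [map_mul, map_sub, map_one, refl_X_left, refl_X_right, refl_refl] at h'
  refine mul_left_cancel₀ (X_sub_X_ne_zero (Nat.lt_succ_self i).ne) ?_
  linear_combination -h - h'

theorem isobaric_of_refl_eq {i : ℕ} {f : MvPolynomial ℕ ℤ} (h : refl i f = f) :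
    isobaric i f = f :=
  isobaric_eq <| by rw [h]; ring

theorem isobaric_isobaric (i : ℕ) (f : MvPolynomial ℕ ℤ) :
    isobaric i (isobaric i f) = isobaric i f :=
  isobaric_of_refl_eq (refl_isobaric i f)

theorem refl_one_sub_X_of_ne {i p : ℕ} (h : p ≠ i) (h' : p ≠ i + 1) :
    refl i (1 - X p) = 1 - X p := by
  rw [map_sub, map_one, refl_X_of_ne h h']

theorem isobaric_mul_of_ne {i p : ℕ} (h : p ≠ i) (h' : p ≠ i + 1) (f : MvPolynomial ℕ ℤ) :
    isobaric i ((1 - X p) * f) = (1 - X p) * isobaric i f :=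
  isobaric_mul_of_refl_eq (refl_one_sub_X_of_ne h h') f

/-- This rule, `isobaric_mul_right` and `isobaric_mul_of_ne` move a factor `1 - x_p` past `π_i`.
They give closure of the Grothendieck span under multiplication, and they are the pattern that the
operators of `1 - κ_p` have to match. -/
theorem isobaric_mul_left (i : ℕ) (f : MvPolynomial ℕ ℤ) :
    isobaric i ((1 - X i) * f) = (1 - X (i + 1)) * (isobaric i f - f) :=
  isobaric_eq <| by
    simp only [map_mul, map_sub, map_one, refl_X_left]
    linear_combination (1 - X (i + 1)) * isobaric_spec i f

theorem isobaric_mul_right (i : ℕ) (f : MvPolynomial ℕ ℤ) :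
    isobaric i ((1 - X (i + 1)) * f) = (1 - X (i + 1)) * f + (1 - X i) * isobaric i f :=
  isobaric_eq <| by
    simp only [map_mul, map_sub, map_one, refl_X_right]
    linear_combination (1 - X i) * isobaric_spec i f

/-- With both denominators cleared, either side is the same combination of `f`, `s_i f`, `s_j f` and
`s_i s_j f`. -/
theorem isobaric_comm {i j : ℕ} (h : i + 1 < j) (f : MvPolynomial ℕ ℤ) :
    isobaric i (isobaric j f) = isobaric j (isobaric i f) := by
  refine isobaric_eq ?_
  refine mul_left_cancel₀ (X_sub_X_ne_zero (Nat.lt_succ_self j).ne) ?_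
  have h1 := isobaric_spec j (isobaric i f)
  have h2 := isobaric_spec j f
  have h3 := isobaric_spec i f
  have h4 := congrArg (refl i) h2
  have h5 := congrArg (refl j) h3
  have e1 : refl i (X j) = X j := refl_X_of_ne (by omega) (by omega)
  have e2 : refl i (X (j + 1)) = X (j + 1) := refl_X_of_ne (by omega) (by omega)
  have e3 : refl j (X i) = X i := refl_X_of_ne (by omega) (by omega)
  have e4 : refl j (X (i + 1)) = X (i + 1) := refl_X_of_ne (by omega) (by omega)
  simp only [map_mul, map_sub, map_one, e1, e2, e3, e4, refl_comm h f] at h4 h5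
  linear_combination (X i - X (i + 1)) * h1 - (1 - X (i + 1)) * h2 + (1 - X (j + 1)) * h3
    + (1 - X i) * h4 - (1 - X j) * h5

/-- Clearing the Vandermonde denominator turns the threefold composite into an explicit alternating
sum over the six permutations of `x_i, x_{i+1}, x_{i+2}`. The other braid word has the same
expansion, which is how `isobaric_braid` follows. -/
theorem X_sub_mul_isobaric_braid (i : ℕ) (f : MvPolynomial ℕ ℤ) :
    (X i - X (i + 1)) * (X (i + 1) - X (i + 2)) * (X i - X (i + 2)) *
      isobaric i (isobaric (i + 1) (isobaric i f)) =
    (1 - X (i + 1)) * (1 - X (i + 2)) ^ 2 * f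
      - (1 - X i) * (1 - X (i + 2)) ^ 2 * refl i f
      - (1 - X (i + 1)) ^ 2 * (1 - X (i + 2)) * refl (i + 1) f
      + (1 - X i) ^ 2 * (1 - X (i + 2)) * refl i (refl (i + 1) f)
      + (1 - X (i + 1)) ^ 2 * (1 - X i) * refl (i + 1) (refl i f)
      - (1 - X i) ^ 2 * (1 - X (i + 1)) * refl i (refl (i + 1) (refl i f)) := by
  have a1 : refl (i + 1) (X i) = X i := refl_X_of_ne (by omega) (by omega)
  have a2 : refl (i + 1) (X (i + 1)) = X (i + 2) := refl_X_left (i + 1)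
  have a4 : refl i (X (i + 2)) = X (i + 2) := refl_X_of_ne (by omega) (by omega)
  have h1 := isobaric_spec i f
  have h1' := congrArg (refl (i + 1)) h1
  have h1'' := congrArg (refl i) h1'
  have h2 := isobaric_spec (i + 1) (isobaric i f)
  rw [show i + 1 + 1 = i + 2 from rfl] at h2
  have h2' := congrArg (refl i) h2
  have h3 := isobaric_spec i (isobaric (i + 1) (isobaric i f))
  simp only [map_mul, map_sub, map_one, a1, a2, a4, refl_X_left, refl_X_right,
    refl_isobaric] at h1' h1'' h2'
  refine mul_left_cancel₀ (X_sub_X_ne_zero (Nat.lt_succ_self i).ne) ?_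
  generalize (X i : MvPolynomial ℕ ℤ) = a at *
  generalize (X (i + 1) : MvPolynomial ℕ ℤ) = b at *
  generalize (X (i + 2) : MvPolynomial ℕ ℤ) = c at *
  linear_combination (a - b) * (b - c) * (a - c) * h3 + (a - b) * (a - c) * (1 - b) * h2
    - (a - b) * (b - c) * (1 - a) * h2' + (a - b) * (1 - c) ^ 2 * h1
    - (a - b) * (1 - b) ^ 2 * h1' + (a - b) * (1 - a) ^ 2 * h1''

theorem isobaric_braid (i : ℕ) (f : MvPolynomial ℕ ℤ) :
    isobaric i (isobaric (i + 1) (isobaric i f)) =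
      isobaric (i + 1) (isobaric i (isobaric (i + 1) f)) := by
  have a1 : refl (i + 1) (X i) = X i := refl_X_of_ne (by omega) (by omega)
  have a2 : refl (i + 1) (X (i + 1)) = X (i + 2) := refl_X_left (i + 1)
  have a3 : refl (i + 1) (X (i + 2)) = X (i + 1) := refl_X_right (i + 1)
  have a4 : refl i (X (i + 2)) = X (i + 2) := refl_X_of_ne (by omega) (by omega)
  have h1 := isobaric_spec (i + 1) f
  rw [show i + 1 + 1 = i + 2 from rfl] at h1
  have h1' := congrArg (refl i) h1
  have h1'' := congrArg (refl (i + 1)) h1'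
  have h2 := isobaric_spec i (isobaric (i + 1) f)
  have h2' := congrArg (refl (i + 1)) h2
  have h3 := isobaric_spec (i + 1) (isobaric i (isobaric (i + 1) f))
  rw [show i + 1 + 1 = i + 2 from rfl] at h3
  simp only [map_mul, map_sub, map_one, a1, a2, a3, a4, refl_X_right,
    refl_isobaric, ← refl_braid i f] at h1' h1'' h2'
  have h4 := X_sub_mul_isobaric_braid i f
  have n1 : (X i - X (i + 1) : MvPolynomial ℕ ℤ) ≠ 0 := X_sub_X_ne_zero (by omega)
  have n2 : (X (i + 1) - X (i + 2) : MvPolynomial ℕ ℤ) ≠ 0 := X_sub_X_ne_zero (by omega)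
  have n3 : (X i - X (i + 2) : MvPolynomial ℕ ℤ) ≠ 0 := X_sub_X_ne_zero (by omega)
  refine mul_left_cancel₀ (mul_ne_zero (mul_ne_zero n1 n2) n3) ?_
  refine mul_left_cancel₀ n2 ?_
  generalize (X i : MvPolynomial ℕ ℤ) = a at *
  generalize (X (i + 1) : MvPolynomial ℕ ℤ) = b at *
  generalize (X (i + 2) : MvPolynomial ℕ ℤ) = c at *
  linear_combination (b - c) * h4 - (a - b) * (b - c) * (a - c) * h3
    - (b - c) * (a - c) * (1 - c) * h2 + (b - c) * (a - b) * (1 - b) * h2'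
    - (b - c) * (1 - b) * (1 - c) * h1 + (b - c) * (1 - c) * (1 - a) * h1'
    - (b - c) * (1 - b) * (1 - a) * h1''

/-! ### Grothendieck polynomials -/

/-- Induction towards the longest element of `S_N`: multiplying by `s_i` at an ascent lowers the
number of non-inversions, and the implicit base case is a `w` without ascents below `N`. -/
theorem nonInv_induction {N : ℕ} {P : Equiv.Perm ℕ → Prop}
    (h : ∀ w, (∀ i, i + 1 < N → w i < w (i + 1) → P (w * Equiv.swap i (i + 1))) → P w)
    (w : Equiv.Perm ℕ) : P w := by
  induction hk : (nonInv N w).card using Nat.strong_induction_on generalizing w with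
  | _ k ih =>
    refine h w fun i hi hw => ih _ ?_ _ rfl
    exact hk ▸ card_nonInv_lt hi hw

theorem mul_swap_succ_apply_of_ne (w : Equiv.Perm ℕ) {i k : ℕ} (h : k ≠ i) (h' : k ≠ i + 1) :
    (w * Equiv.swap i (i + 1)) k = w k := by
  rw [Equiv.Perm.mul_apply, Equiv.swap_apply_of_ne_of_ne h h']

theorem mul_swap_succ_apply_left (w : Equiv.Perm ℕ) (i : ℕ) :
    (w * Equiv.swap i (i + 1)) i = w (i + 1) := by
  rw [Equiv.Perm.mul_apply, Equiv.swap_apply_left]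

theorem mul_swap_succ_apply_right (w : Equiv.Perm ℕ) (i : ℕ) :
    (w * Equiv.swap i (i + 1)) (i + 1) = w i := by
  rw [Equiv.Perm.mul_apply, Equiv.swap_apply_right]

theorem swap_succ_mul_comm {i j : ℕ} (h : i + 1 < j) :
    Equiv.swap i (i + 1) * Equiv.swap j (j + 1) = Equiv.swap j (j + 1) * Equiv.swap i (i + 1) := by
  ext k
  simp only [Equiv.Perm.mul_apply, Equiv.swap_apply_def]
  grind

theorem swap_succ_braid (i : ℕ) :
    Equiv.swap i (i + 1) * Equiv.swap (i + 1) (i + 2) * Equiv.swap i (i + 1) =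
      Equiv.swap (i + 1) (i + 2) * Equiv.swap i (i + 1) * Equiv.swap (i + 1) (i + 2) := by
  ext k
  simp only [Equiv.Perm.mul_apply, Equiv.swap_apply_def]
  grind

theorem exists_grothendieckAux_eq {N : ℕ} {w : Equiv.Perm ℕ}
    (h : ∃ i, i + 1 < N ∧ w i < w (i + 1)) :
    ∃ j, j + 1 < N ∧ w j < w (j + 1) ∧ (∀ i, i + 1 < N → w i < w (i + 1) → j ≤ i) ∧
      grothendieckAux N w = isobaric j (grothendieckAux N (w * Equiv.swap j (j + 1))) := by
  classical
  refine ⟨Nat.find h, (Nat.find_spec h).1, (Nat.find_spec h).2,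
    fun i hi hw => Nat.find_min' h ⟨hi, hw⟩, ?_⟩
  rw [grothendieckAux, dif_pos h]

/-- The recursion for Grothendieck polynomials holds at every ascent. -/
theorem grothendieckAux_of_lt {N i : ℕ} {w : Equiv.Perm ℕ} (hi : i + 1 < N)
    (hw : w i < w (i + 1)) :
    grothendieckAux N w = isobaric i (grothendieckAux N (w * Equiv.swap i (i + 1))) := by
  induction hk : (nonInv N w).card using Nat.strong_induction_on generalizing w i with
  | _ k ih =>
  replace ih : ∀ (w' : Equiv.Perm ℕ) (i : ℕ), (nonInv N w').card < (nonInv N w).card →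
      i + 1 < N → w' i < w' (i + 1) →
      grothendieckAux N w' = isobaric i (grothendieckAux N (w' * Equiv.swap i (i + 1))) :=
    fun w' i h h1 h2 => ih _ (hk ▸ h) h1 h2 rfl
  obtain ⟨j, hj, hwj, hle, e⟩ := exists_grothendieckAux_eq ⟨i, hi, hw⟩
  have b1 := mul_swap_succ_apply_left w j
  have b2 := mul_swap_succ_apply_right w j
  have b3 := fun k => mul_swap_succ_apply_of_ne w (i := j) (k := k)
  have c1 := mul_swap_succ_apply_left w i
  have c2 := mul_swap_succ_apply_right w i
  have c3 := fun k => mul_swap_succ_apply_of_ne w (i := i) (k := k)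
  -- Diamond argument: `j` is the first ascent, used by the definition, and `i` is any ascent. If `i
  -- = j + 1`, two further steps from each side meet at `w s_j s_{j+1} s_j` and the braid relations
  -- identify the results; if `i > j + 1`, one further step meets at `w s_j s_i`.
  rcases (hle i hi hw).eq_or_lt with rfl | hlt
  · exact e
  rcases (Nat.succ_le_of_lt hlt).eq_or_lt with rfl | hlt'
  · have d1 := fun k => mul_swap_succ_apply_of_ne (w * Equiv.swap j (j + 1)) (i := j + 1) (k := k)
    have d2 := mul_swap_succ_apply_left (w * Equiv.swap j (j + 1)) (j + 1)
    have f1 := fun k => mul_swap_succ_apply_of_ne (w * Equiv.swap (j + 1) (j + 2)) (i := j) (k := k)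
    have f2 := mul_swap_succ_apply_right (w * Equiv.swap (j + 1) (j + 2)) j
    simp only [Nat.succ_eq_add_one, show j + 1 + 1 = j + 2 from rfl] at *
    have i1 : (w * Equiv.swap j (j + 1)) (j + 1) < (w * Equiv.swap j (j + 1)) (j + 2) := by grind
    have i2 : (w * Equiv.swap (j + 1) (j + 2)) j < (w * Equiv.swap (j + 1) (j + 2)) (j + 1) := by
      grind
    have j1 : (w * Equiv.swap j (j + 1) * Equiv.swap (j + 1) (j + 2)) j <
        (w * Equiv.swap j (j + 1) * Equiv.swap (j + 1) (j + 2)) (j + 1) := by grind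
    have j2 : (w * Equiv.swap (j + 1) (j + 2) * Equiv.swap j (j + 1)) (j + 1) <
        (w * Equiv.swap (j + 1) (j + 2) * Equiv.swap j (j + 1)) (j + 2) := by grind
    have k1 := card_nonInv_lt hj hwj
    have k2 := card_nonInv_lt hi hw
    have k3 := (card_nonInv_lt hi i1).trans k1
    have k4 := (card_nonInv_lt hj i2).trans k2
    rw [e, ih _ _ k1 hi i1, ih _ _ k2 hj i2, ih _ _ k3 hj j1, ih _ _ k4 hi j2]
    simp only [mul_assoc]
    simp only [← mul_assoc, show j + 1 + 1 = j + 2 from rfl]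
    rw [isobaric_braid, mul_assoc w, mul_assoc w, mul_assoc w, mul_assoc w, swap_succ_braid]
  · have i1 : (w * Equiv.swap j (j + 1)) i < (w * Equiv.swap j (j + 1)) (i + 1) := by grind
    have i2 : (w * Equiv.swap i (i + 1)) j < (w * Equiv.swap i (i + 1)) (j + 1) := by grind
    rw [e, ih _ _ (card_nonInv_lt hj hwj) hi i1, ih _ _ (card_nonInv_lt hi hw) hj i2, mul_assoc,
      mul_assoc, swap_succ_mul_comm hlt', isobaric_comm hlt']

/-! ### Stability -/

/-- The staircase monomial `x_0^{N-1} x_1^{N-2} ⋯` times the product of the variables in `T`. -/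
noncomputable def stair (N : ℕ) (T : Finset ℕ) : MvPolynomial ℕ ℤ :=
  ∏ i ∈ Finset.range (N + 1), X i ^ (N - 1 - i + if i ∈ T then 1 else 0)

theorem stair_empty (N : ℕ) : stair N ∅ = ∏ i ∈ Finset.range N, X i ^ (N - 1 - i) := by
  simp [stair, Finset.prod_range_succ]

theorem stair_range (N : ℕ) :
    stair N (Finset.range N) = ∏ i ∈ Finset.range (N + 1), X i ^ (N + 1 - 1 - i) := by
  refine Finset.prod_congr rfl fun i hi => ?_
  simp only [Finset.mem_range] at *
  congr 1
  split_ifs <;> omega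

theorem stair_insert {N k : ℕ} {T : Finset ℕ} (hk : k ≤ N) (hT : k ∉ T) :
    stair N (insert k T) = X k * stair N T := by
  have h : (X k : MvPolynomial ℕ ℤ) =
      ∏ i ∈ Finset.range (N + 1), X i ^ (if i = k then 1 else 0) := by
    rw [Finset.prod_eq_single k]
    · simp
    · intro b _ hb; simp [hb]
    · intro h; simp at h; omega
  rw [h, stair, stair, ← Finset.prod_mul_distrib]
  refine Finset.prod_congr rfl fun i _ => ?_
  rw [← pow_add]
  congr 1
  by_cases hik : i = k
  · subst hik; simp [hT]; omega
  · simp [hik]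

theorem refl_prod_range {M k : ℕ} (hk : k + 1 < M) {e : ℕ → ℕ} (he : e k = e (k + 1)) :
    refl k (∏ i ∈ Finset.range M, X i ^ e i) = ∏ i ∈ Finset.range M, X i ^ e i := by
  rw [map_prod]
  refine Finset.prod_equiv (Equiv.swap k (k + 1)) (fun i => ?_) fun i _ => ?_
  · simp only [Finset.mem_range, Equiv.swap_apply_def]
    split_ifs <;> omega
  · rw [map_pow, rename_X]
    congr 1
    rw [Equiv.swap_apply_def]
    split_ifs with h1 h2
    · rw [h1, he]
    · rw [h2, he]
    · rfl

/-- The condition on `k + 1` makes the exponents of `x_k` and `x_{k+1}` in `stair N T` equal, also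
for `k + 1 = N`, where the truncated exponent of `x_N` is `0`. So `stair N T` is symmetric in the
two variables, and `π_k` strips the factor `x_k`. -/
theorem isobaric_stair_insert {N k : ℕ} {T : Finset ℕ} (hk : k < N) (hkT : k ∉ T)
    (hT : k + 1 ∈ T ↔ k + 1 < N) : isobaric k (stair N (insert k T)) = stair N T := by
  rw [stair_insert hk.le hkT]
  refine isobaric_X_mul_of_refl_eq (refl_prod_range (by omega) ?_)
  simp only [hkT, hT, if_false]
  split_ifs <;> omega

theorem lt_of_fixed {N : ℕ} {w : Equiv.Perm ℕ} (h : ∀ i, N ≤ i → w i = i) {a : ℕ} (ha : a < N) :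
    w a < N := by
  by_contra! hc
  have := w.injective (h _ hc)
  omega

theorem lt_of_fixed_of_ne {N k : ℕ} {w : Equiv.Perm ℕ} (hfix : ∀ i, N + 1 ≤ i → w i = i)
    (hwk : w k = N) {a : ℕ} (ha : a ≠ k) (haN : a ≤ N) : w a < N := by
  have h1 := lt_of_fixed hfix (a := a) (by omega)
  have h2 : w a ≠ w k := fun h => ha (w.injective h)
  omega

/-- Start from the longest element of `S_{N+1}` and move its largest value to the right: each step
from position `k` to `k + 1` applies `π_k` and removes one factor `x_k`. At `k = N` the permutation
is the longest element of `S_N`, which is the case of stability that the recursion does not cover.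
-/
theorem grothendieckAux_succ_of_decreasing {N k : ℕ} {w : Equiv.Perm ℕ} (hk : k ≤ N)
    (hfix : ∀ i, N + 1 ≤ i → w i = i) (hwk : w k = N)
    (hw : ∀ a b, a < b → b ≤ N → a ≠ k → b ≠ k → w b < w a) :
    grothendieckAux (N + 1) w = stair N (Finset.Ico k N) := by
  induction k generalizing w with
  | zero =>
    rw [grothendieckAux, dif_neg, ← Finset.range_eq_Ico, stair_range]
    rintro ⟨i, hi, hlt'⟩
    rcases Nat.eq_zero_or_pos i with rfl | h
    · have := lt_of_fixed_of_ne hfix hwk (a := 1) (by omega) (by omega)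
      simp only [zero_add] at *
      omega
    · have := hw i (i + 1) (by omega) (by omega) (by omega) (by omega)
      omega
  | succ k ih =>
    have c1 := mul_swap_succ_apply_left w k
    have c2 := mul_swap_succ_apply_right w k
    have c3 := fun j => mul_swap_succ_apply_of_ne w (i := k) (k := j)
    have hlt : w k < w (k + 1) := hwk ▸ lt_of_fixed_of_ne hfix hwk (by omega) (by omega)
    rw [grothendieckAux_of_lt (by omega) hlt,
      ih (w := w * Equiv.swap k (k + 1)) (by omega), ← Finset.insert_Ico_succ_left_eq_Ico hk]
    · exact isobaric_stair_insert hk (by simp) (by simp [Finset.mem_Ico])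
    · intro i hi
      rw [c3 i (by omega) (by omega), hfix i hi]
    · rw [c1, hwk]
    · intro a b hab hb ha hb'
      rcases eq_or_ne a (k + 1) with rfl | ha1
      · rw [c2, c3 b (by omega) (by omega)]
        exact hw k b (by omega) hb (by omega) (by omega)
      · rcases eq_or_ne b (k + 1) with rfl | hb1
        · rw [c2, c3 a ha ha1]
          exact hw a k (by omega) (by omega) (by omega) (by omega)
        · rw [c3 a ha ha1, c3 b hb' hb1]
          exact hw a b hab hb ha1 hb1

theorem grothendieckAux_succ {N : ℕ} {w : Equiv.Perm ℕ} (hfix : ∀ i, N ≤ i → w i = i) :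
    grothendieckAux (N + 1) w = grothendieckAux N w := by
  induction w using nonInv_induction (N := N) with
  | h w ih =>
  by_cases h : ∃ i, i + 1 < N ∧ w i < w (i + 1)
  · obtain ⟨i, hi, hw⟩ := h
    rw [grothendieckAux_of_lt hi hw, grothendieckAux_of_lt (by omega) hw, ih i hi hw]
    intro j hj
    rw [mul_swap_succ_apply_of_ne _ (by omega) (by omega), hfix j hj]
  · rw [grothendieckAux_succ_of_decreasing le_rfl (fun i hi => hfix i (by omega)) (hfix N le_rfl),
      Finset.Ico_self, stair_empty, grothendieckAux, dif_neg h]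
    intro a b hab hb _ hbN
    push Not at h
    induction b, hab using Nat.le_induction with
    | base =>
      exact (h a (by omega)).lt_of_ne fun e => by simpa using w.injective e
    | succ b hab ihb =>
      have h1 : w (b + 1) < w b :=
        (h b (by omega)).lt_of_ne fun e => by simpa using w.injective e
      exact h1.trans (ihb (by omega) (by omega))

theorem grothendieck_eq {w : SInf} {N : ℕ} (h : ∀ i, N ≤ i → w.1 i = i) :
    grothendieck w = grothendieckAux N w.1 := by
  classical
  rw [grothendieck]
  have hle : Nat.find w.2 ≤ N := Nat.find_min' w.2 h
  have hspec := Nat.find_spec w.2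
  induction N, hle using Nat.le_induction with
  | base => congr
  | succ N hle ih =>
    have hN : ∀ i, N ≤ i → w.1 i = i := fun i hi => hspec i (hle.trans hi)
    rw [ih hN, grothendieckAux_succ hN]

/-- The element `w s_i` of `S_∞`. -/
def mulSwap (i : ℕ) (w : SInf) : SInf :=
  ⟨w.1 * Equiv.swap i (i + 1), by
    obtain ⟨N, hN⟩ := w.2
    refine ⟨N + i + 2, fun j hj => ?_⟩
    rw [mul_swap_succ_apply_of_ne _ (by omega) (by omega), hN j (by omega)]⟩

theorem mulSwap_mulSwap (i : ℕ) (w : SInf) : mulSwap i (mulSwap i w) = w :=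
  Subtype.ext <| by simp [mulSwap, mul_assoc]

theorem mulSwap_fixed {i N : ℕ} {w : SInf} (h : ∀ j, N ≤ j → w.1 j = j) (hi : i + 1 < N) :
    ∀ j, N ≤ j → (mulSwap i w).1 j = j := fun j hj => by
  rw [mulSwap, mul_swap_succ_apply_of_ne _ (by omega) (by omega), h j hj]

/-! ### Recursion and symmetry for Grothendieck polynomials on `S_∞`. -/

theorem grothendieck_of_lt {w : SInf} {i : ℕ} (h : w.1 i < w.1 (i + 1)) :
    grothendieck w = isobaric i (grothendieck (mulSwap i w)) := by
  obtain ⟨N, hN⟩ := w.2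
  -- The bound is enlarged so that both positions `i` and `i + 1` lie in its range.
  have h1 : ∀ j, N + i + 2 ≤ j → w.1 j = j := fun j hj => hN j (by omega)
  rw [grothendieck_eq h1, grothendieck_eq (mulSwap_fixed h1 (i := i) (by omega)),
    grothendieckAux_of_lt (by omega) h]
  rfl

theorem isobaric_grothendieck_of_lt {w : SInf} {i : ℕ} (h : w.1 i < w.1 (i + 1)) :
    isobaric i (grothendieck w) = grothendieck w := by
  rw [grothendieck_of_lt h, isobaric_isobaric]

theorem refl_grothendieck_of_lt {w : SInf} {i : ℕ} (h : w.1 i < w.1 (i + 1)) :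
    refl i (grothendieck w) = grothendieck w := by
  rw [grothendieck_of_lt h, refl_isobaric]

theorem isobaric_grothendieck_of_gt {w : SInf} {i : ℕ} (h : w.1 (i + 1) < w.1 i) :
    isobaric i (grothendieck w) = grothendieck (mulSwap i w) := by
  rw [grothendieck_of_lt (w := mulSwap i w) (i := i), mulSwap_mulSwap]
  rw [mulSwap, mul_swap_succ_apply_left, mul_swap_succ_apply_right]
  exact h

/-- The identity of `S_∞`. -/
def oneSInf : SInf := ⟨1, 0, fun _ _ => rfl⟩

theorem grothendieck_one : grothendieck oneSInf = 1 := by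
  rw [grothendieck_eq (N := 0) fun _ _ => rfl, grothendieckAux, dif_neg (by omega)]
  simp

/-- For `k + 1 ≥ n` there is an ascent at `k`, so `𝔊_w` is symmetric in `x_k` and `x_{k+1}`. If one
such variable occurred, all later ones would, but a polynomial has finitely many variables. -/
theorem lt_of_mem_vars_grothendieck {n : ℕ} {w : SInf} (h : ∀ i, n ≤ i → w.1 i = i) {j : ℕ}
    (hj : j ∈ (grothendieck w).vars) : j + 1 < n := by
  classical
  by_contra! hc
  have key : ∀ k, n ≤ k + 1 → k ∈ (grothendieck w).vars → k + 1 ∈ (grothendieck w).vars := by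
    intro k hk hkv
    have h1 : w.1 k < w.1 (k + 1) := by
      rw [h (k + 1) hk]
      exact lt_of_fixed (fun i hi => h i (by omega)) (by omega)
    have h2 := refl_grothendieck_of_lt h1
    rw [← h2] at hkv
    obtain ⟨l, hl, hlk⟩ := mem_vars_rename _ _ hkv
    have hlk' : l = k + 1 := by
      rw [← Equiv.swap_apply_left k (k + 1)]
      exact (Equiv.swap_apply_eq_iff.mp hlk)
    exact hlk' ▸ hl
  have all : ∀ k, j + k ∈ (grothendieck w).vars := fun k => by
    induction k with
    | zero => exact hj
    | succ k ih => exact key (j + k) (by omega) ih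
  have := Finset.le_sup (f := id) (all ((grothendieck w).vars.sup id + 1))
  simp only [id] at this
  omega

/-! ### Lowest degrees -/

/-- The ideal of polynomials without constant term. -/
noncomputable abbrev augmentation : Ideal (MvPolynomial ℕ ℤ) := RingHom.ker constantCoeff

theorem divDiff_eq {i : ℕ} {f q : MvPolynomial ℕ ℤ}
    (h : f - refl i f = (X i - X (i + 1)) * q) : divDiff i f = q :=
  mul_left_cancel₀ (X_sub_X_ne_zero (Nat.lt_succ_self i).ne) ((divDiff_spec i f).symm.trans h)

theorem divDiff_add (i : ℕ) (f g : MvPolynomial ℕ ℤ) :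
    divDiff i (f + g) = divDiff i f + divDiff i g :=
  divDiff_eq <| by rw [map_add]; linear_combination divDiff_spec i f + divDiff_spec i g

theorem divDiff_mul (i : ℕ) (f g : MvPolynomial ℕ ℤ) :
    divDiff i (f * g) = divDiff i f * g + refl i f * divDiff i g :=
  divDiff_eq <| by
    rw [map_mul]
    linear_combination g * divDiff_spec i f + refl i f * divDiff_spec i g

/-- Powers of the augmentation ideal filter polynomials by lowest degree, and a divided difference
lowers that degree by at most one; the twisted Leibniz rule gives the induction. -/
theorem divDiff_mem_pow {i k : ℕ} {f : MvPolynomial ℕ ℤ} (hf : f ∈ augmentation ^ (k + 1)) :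
    divDiff i f ∈ augmentation ^ k := by
  induction k generalizing f with
  | zero => simp
  | succ k ih =>
    rw [pow_succ'] at hf
    refine Submodule.mul_induction_on hf (fun a ha b hb => ?_) fun a b ha hb => ?_
    · rw [divDiff_mul]
      refine add_mem (Ideal.mul_mem_left _ _ hb) ?_
      rw [pow_succ']
      refine Ideal.mul_mem_mul ?_ (ih hb)
      rw [RingHom.mem_ker] at ha ⊢
      rw [constantCoeff_rename, ha]
    · rw [divDiff_add]
      exact add_mem ha hb

theorem isobaric_mem_pow {i k : ℕ} {f : MvPolynomial ℕ ℤ} (hf : f ∈ augmentation ^ (k + 1)) :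
    isobaric i f ∈ augmentation ^ k :=
  divDiff_mem_pow (Ideal.mul_mem_left _ _ hf)

/-- For `w` in `S_N` the exponent is `l(w)`: all pairs of positions minus the non-inverted ones.
Every step of the recursion loses at most one degree, starting from the full staircase. -/
theorem grothendieckAux_mem_pow (N : ℕ) (w : Equiv.Perm ℕ) :
    grothendieckAux N w ∈
      augmentation ^ ((∑ i ∈ Finset.range N, (N - 1 - i)) - (nonInv N w).card) := by
  induction w using nonInv_induction (N := N) with
  | h w ih =>
  by_cases h : ∃ i, i + 1 < N ∧ w i < w (i + 1)
  · obtain ⟨i, hi, hw⟩ := h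
    rw [grothendieckAux_of_lt hi hw]
    have hc := card_nonInv_lt hi hw
    by_cases h0 : (∑ i ∈ Finset.range N, (N - 1 - i)) - (nonInv N w).card = 0
    · simp [h0]
    · exact isobaric_mem_pow (Ideal.pow_le_pow_right (by omega) (ih i hi hw))
  · rw [grothendieckAux, dif_neg h]
    refine Ideal.pow_le_pow_right (Nat.sub_le _ _) ?_
    rw [← Finset.prod_pow_eq_pow_sum]
    exact Ideal.prod_mem_prod fun i _ => Ideal.pow_mem_pow (by simp [RingHom.mem_ker]) _

theorem card_pairs (N : ℕ) :
    ((Finset.range N ×ˢ Finset.range N).filter fun p => p.1 < p.2).card =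
      ∑ i ∈ Finset.range N, (N - 1 - i) := by
  rw [Finset.card_filter, Finset.sum_product]
  refine Finset.sum_congr rfl fun i hi => ?_
  rw [← Finset.card_filter]
  have : (Finset.range N).filter (fun j => i < j) = Finset.Ioo i N := by
    ext j; simp; omega
  rw [this, Nat.card_Ioo]
  omega

theorem constantCoeff_grothendieck_of_gt {w : SInf} {i : ℕ} (h : w.1 (i + 1) < w.1 i) :
    constantCoeff (grothendieck w) = 0 := by
  obtain ⟨N, hN⟩ := w.2
  have h1 : ∀ j, N + i + 2 ≤ j → w.1 j = j := fun j hj => hN j (by omega)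
  rw [grothendieck_eq h1, ← RingHom.mem_ker]
  -- The descent makes the pair `(i, i + 1)` inverted, so the exponent `l(w)` is positive.
  have hlt : (nonInv (N + i + 2) w.1).card <
      ∑ j ∈ Finset.range (N + i + 2), (N + i + 2 - 1 - j) := by
    rw [← card_pairs]
    refine Finset.card_lt_card ⟨?_, fun hs => ?_⟩
    · intro p hp
      simp only [nonInv, Finset.mem_filter] at hp ⊢
      exact ⟨hp.1, hp.2.1⟩
    · have := hs (x := (i, i + 1)) (by simp; omega)
      simp only [nonInv, Finset.mem_filter] at this
      omega
  have := Ideal.pow_le_pow_right (Nat.sub_pos_of_lt hlt) (grothendieckAux_mem_pow (N + i + 2) w.1)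
  rwa [pow_one] at this

/-! ### Demazure operators on free modules -/

/-- The hypothesis says that the fibre of `d` over `w'` is `{w, w'}`. This is the situation of a
Demazure operator that removes a descent of `w`, with `w'` the result. -/
theorem mapDomain_apply_of_iff {G : Type*} {d : G → G} {w w' : G} (hne : w' ≠ w)
    (h : ∀ v, d v = w' ↔ v = w ∨ v = w') (c : G →₀ ℤ) :
    Finsupp.mapDomain d c w' = c w + c w' := by
  classical
  induction c using Finsupp.induction_linear with
  | zero => simp
  | add f g hf hg => rw [Finsupp.mapDomain_add, Finsupp.add_apply, hf, hg]; simp; ring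
  | single v a =>
    rw [Finsupp.mapDomain_single]
    simp only [Finsupp.single_apply, h v]
    by_cases h1 : v = w
    · subst h1; simp [hne.symm]
    · simp [h1]

/-- A set of elements of `ℤ⟨G⟩` that is stable under operators `d i` which connect every element
of `G` to `e`, and on which the coefficient of `e` vanishes, contains at most zero. -/
theorem eq_zero_of_stable {G ι : Type*} {d : ι → G → G} {e : G}
    (hind : ∀ P : G → Prop, P e →
      (∀ w i w', w' ≠ w → (∀ v, d i v = w' ↔ v = w ∨ v = w') → P w' → P w) → ∀ w, P w)
    {K : Set (G →₀ ℤ)} (hK : ∀ i, ∀ c ∈ K, Finsupp.mapDomain (d i) c ∈ K)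
    (he : ∀ c ∈ K, c e = 0) {c : G →₀ ℤ} (hc : c ∈ K) : c = 0 := by
  have key : ∀ w, ∀ c ∈ K, c w = 0 := by
    refine hind _ he fun w i w' hne h ih c hc => ?_
    -- The coefficients at `w'` of both `c` and its image under `d i` vanish by induction, and the
    -- latter is `c w + c w'`.
    have h1 := mapDomain_apply_of_iff hne h c
    rw [ih _ (hK i c hc), ih c hc] at h1
    omega
  ext w
  exact key w c hc

/-! ### Descents and induction in `S_∞`. -/

theorem lt_succ_of_fixed {N i : ℕ} {w : Equiv.Perm ℕ} (h : ∀ j, N ≤ j → w j = j)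
    (hi : N ≤ i + 1) : w i < w (i + 1) := by
  rw [h (i + 1) hi]
  exact lt_of_fixed (fun j hj => h j (by omega)) (by omega)

/-- Without descents, `w` and its inverse are strictly increasing maps of `ℕ`, hence both at least
the identity. -/
theorem exists_descent {w : SInf} (hw : w ≠ oneSInf) : ∃ i, w.1 (i + 1) < w.1 i := by
  by_contra! h
  have hmono : StrictMono w.1 := strictMono_nat_of_lt_succ fun i =>
    (h i).lt_of_ne fun e => by simpa using w.1.injective e
  have hmono' : StrictMono w.1.symm := fun a b hab => by
    rw [← hmono.lt_iff_lt, Equiv.apply_symm_apply, Equiv.apply_symm_apply]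
    exact hab
  refine hw (Subtype.ext (Equiv.ext fun i => le_antisymm ?_ hmono.le_apply))
  have := hmono'.le_apply (x := w.1 i)
  rwa [Equiv.symm_apply_apply] at this

theorem mulSwap_lt {w : SInf} {i : ℕ} (h : w.1 (i + 1) < w.1 i) :
    (mulSwap i w).1 i < (mulSwap i w).1 (i + 1) := by
  rwa [mulSwap, mul_swap_succ_apply_left, mul_swap_succ_apply_right]

theorem sInf_induction {P : SInf → Prop} (one : P oneSInf)
    (step : ∀ w i, w.1 (i + 1) < w.1 i → P (mulSwap i w) → P w) (w : SInf) : P w := by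
  obtain ⟨N, hN⟩ := w.2
  -- Up to a constant this measure is the number of inversions; `N * N` is a crude bound that keeps
  -- the truncated subtraction faithful.
  induction hk : N * N - (nonInv N w.1).card using Nat.strong_induction_on generalizing w with
  | _ k ih =>
  by_cases hw : w = oneSInf
  · exact hw ▸ one
  obtain ⟨i, hi⟩ := exists_descent hw
  have hiN : i + 1 < N := by
    by_contra! hc
    exact (lt_succ_of_fixed hN hc).asymm hi
  refine step w i hi (ih _ ?_ (mulSwap i w) (mulSwap_fixed hN hiN) rfl)
  have h1 := card_nonInv_lt hiN (mulSwap_lt hi)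
  have h2 : (mulSwap i w).1 * Equiv.swap i (i + 1) = w.1 :=
    congrArg Subtype.val (mulSwap_mulSwap i w)
  rw [h2] at h1
  have h3 : (nonInv N (mulSwap i w).1).card ≤ N * N := by
    refine (Finset.card_filter_le _ _).trans ?_
    simp
  omega

/-- Right Demazure action of `s_i` on `S_∞`: remove a descent at `i` if there is one. -/
noncomputable def demazure (i : ℕ) (w : SInf) : SInf :=
  if w.1 (i + 1) < w.1 i then mulSwap i w else w

theorem mulSwap_ne (i : ℕ) (w : SInf) : mulSwap i w ≠ w := fun h => by
  have h1 := congrArg (fun v : SInf => v.1 i) h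
  simp only [mulSwap, mul_swap_succ_apply_left] at h1
  simpa using w.1.injective h1

theorem demazure_eq_iff {w : SInf} {i : ℕ} (hi : w.1 (i + 1) < w.1 i) (v : SInf) :
    demazure i v = mulSwap i w ↔ v = w ∨ v = mulSwap i w := by
  have h1 := mulSwap_lt hi
  constructor
  · intro h
    rw [demazure] at h
    split_ifs at h
    · left
      rw [← mulSwap_mulSwap i v, h, mulSwap_mulSwap]
    · exact Or.inr h
  · rintro (rfl | rfl)
    · rw [demazure, if_pos hi]
    · rw [demazure, if_neg h1.asymm]

/-! ### The basis of Grothendieck polynomials -/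

/-- The linear map that sends `w` to the Grothendieck polynomial `𝔊_w`. -/
noncomputable def grothendieckLin : (SInf →₀ ℤ) →ₗ[ℤ] MvPolynomial ℕ ℤ :=
  Finsupp.linearCombination ℤ grothendieck

theorem grothendieckLin_single (w : SInf) (a : ℤ) :
    grothendieckLin (Finsupp.single w a) = a • grothendieck w :=
  Finsupp.linearCombination_single ℤ a w

theorem isobaric_grothendieck (i : ℕ) (w : SInf) :
    isobaric i (grothendieck w) = grothendieck (demazure i w) := by
  rw [demazure]
  split_ifs with h
  · exact isobaric_grothendieck_of_gt h
  · refine isobaric_grothendieck_of_lt ((not_lt.mp h).lt_of_ne fun e => ?_)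
    simpa using w.1.injective e

theorem isobaric_grothendieckLin (i : ℕ) (c : SInf →₀ ℤ) :
    isobaric i (grothendieckLin c) = grothendieckLin (Finsupp.mapDomain (demazure i) c) := by
  have h : isobaricLin i ∘ₗ grothendieckLin =
      grothendieckLin ∘ₗ Finsupp.lmapDomain ℤ ℤ (demazure i) := by
    refine Finsupp.lhom_ext fun w a => ?_
    simp only [LinearMap.comp_apply, grothendieckLin_single, Finsupp.lmapDomain_apply,
      Finsupp.mapDomain_single, map_smul, isobaricLin_apply, isobaric_grothendieck]
  exact LinearMap.congr_fun h c

/-- A nontrivial `w` has a descent, hence no constant term in `𝔊_w`; only `𝔊_1 = 1` contributes. -/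
theorem constantCoeff_grothendieckLin (c : SInf →₀ ℤ) :
    constantCoeff (grothendieckLin c) = c oneSInf := by
  classical
  induction c using Finsupp.induction_linear with
  | zero => simp
  | add f g hf hg => rw [map_add, map_add, hf, hg, Finsupp.add_apply]
  | single w a =>
    rw [grothendieckLin_single, constantCoeff_smul, Finsupp.single_apply]
    split_ifs with h
    · rw [h, grothendieck_one, map_one, smul_eq_mul, mul_one]
    · obtain ⟨i, hi⟩ := exists_descent h
      rw [constantCoeff_grothendieck_of_gt hi, smul_zero]

/-- The rigidity principle applied to the kernel: it is stable because `π_i` permits the Demazure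
action to be read on coefficients, and the coefficient of the identity is the constant term. -/
theorem grothendieckLin_injective : Function.Injective grothendieckLin := by
  rw [injective_iff_map_eq_zero]
  intro c hc
  refine eq_zero_of_stable (d := demazure) (e := oneSInf) (K := {c | grothendieckLin c = 0})
    ?_ ?_ ?_ hc
  · exact fun P h1 h2 => sInf_induction h1 fun w i hi =>
      h2 w i _ (mulSwap_ne i w) (demazure_eq_iff hi)
  · intro i c hc
    rw [Set.mem_ofPred_eq] at hc ⊢
    rw [← isobaric_grothendieckLin, hc]
    exact map_zero (isobaricLin i)
  · intro c hc
    rw [Set.mem_ofPred_eq] at hc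
    rw [← constantCoeff_grothendieckLin, hc, map_zero]

/-- The span of all Grothendieck polynomials. -/
noncomputable abbrev grothendieckSpan : Submodule ℤ (MvPolynomial ℕ ℤ) :=
  LinearMap.range grothendieckLin

theorem grothendieck_mem_span (w : SInf) : grothendieck w ∈ grothendieckSpan :=
  ⟨Finsupp.single w 1, by rw [grothendieckLin_single, one_smul]⟩

theorem isobaric_mem_span (i : ℕ) {f : MvPolynomial ℕ ℤ} (hf : f ∈ grothendieckSpan) :
    isobaric i f ∈ grothendieckSpan := by
  obtain ⟨c, rfl⟩ := hf
  exact ⟨_, (isobaric_grothendieckLin i c).symm⟩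

/-! ### The Grothendieck polynomials span. -/

theorem exists_no_ascent (N : ℕ) :
    ∃ w : Equiv.Perm ℕ, (∀ i, N ≤ i → w i = i) ∧ ¬ ∃ i, i + 1 < N ∧ w i < w (i + 1) := by
  have key : ∀ w : Equiv.Perm ℕ, (∀ i, N ≤ i → w i = i) →
      ∃ w : Equiv.Perm ℕ, (∀ i, N ≤ i → w i = i) ∧ ¬ ∃ i, i + 1 < N ∧ w i < w (i + 1) := by
    refine nonInv_induction (N := N) fun w ih hw => ?_
    by_cases h : ∃ i, i + 1 < N ∧ w i < w (i + 1)
    · obtain ⟨i, hi, hlt⟩ := h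
      refine ih i hi hlt fun j hj => ?_
      rw [mul_swap_succ_apply_of_ne _ (by omega) (by omega), hw j hj]
    · exact ⟨w, hw, h⟩
  exact key 1 fun _ _ => rfl

theorem stair_Ico_mem_span {N k : ℕ} (hk : k ≤ N) :
    stair N (Finset.Ico k N) ∈ grothendieckSpan := by
  induction k with
  | zero =>
    obtain ⟨w, hw, h⟩ := exists_no_ascent (N + 1)
    have := grothendieck_mem_span ⟨w, N + 1, hw⟩
    rwa [grothendieck_eq (w := ⟨w, N + 1, hw⟩) hw, grothendieckAux, dif_neg h, ← stair_range,
      Finset.range_eq_Ico] at this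
  | succ k ih =>
    have := isobaric_mem_span k (ih (by omega))
    rwa [← Finset.insert_Ico_succ_left_eq_Ico hk,
      isobaric_stair_insert hk (by simp) (by simp [Finset.mem_Ico])] at this

/-- Starting from `Ico p N`, the operators `π_{p+1}, …, π_{k-1}` strip their variables but leave
`x_p`. For `k = N` this puts `x_p` times the staircase of `S_N` into the span. -/
theorem stair_insert_Ico_mem_span {N p k : ℕ} (hpk : p < k) (hk : k ≤ N) :
    stair N (insert p (Finset.Ico k N)) ∈ grothendieckSpan := by
  induction k, hpk using Nat.le_induction with
  | base =>
    have h : insert p (Finset.Ico p.succ N) = Finset.Ico p N :=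
      Finset.insert_Ico_succ_left_eq_Ico hk
    rw [h]
    exact stair_Ico_mem_span (by omega)
  | succ k hpk ih =>
    have := isobaric_mem_span k (ih (by omega))
    rwa [← Finset.insert_Ico_succ_left_eq_Ico hk, Finset.insert_comm, isobaric_stair_insert hk]
      at this
    · simp; omega
    · simp only [Finset.mem_insert, Finset.mem_Ico, Nat.succ_eq_succ, Nat.succ_eq_add_one]; omega

/-- Write `𝔊_w = π_i 𝔊_{w s_i}` and move `1 - x_p` past `π_i`. The terms that arise involve only
`𝔊_{w s_i}` times `1 - x_q` with `q < N`, so the induction treats all `p` at once and ends at the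
staircase monomial. -/
theorem one_sub_X_mul_grothendieckAux_mem_span {N : ℕ} {w : Equiv.Perm ℕ}
    (hw : ∀ i, N ≤ i → w i = i) {p : ℕ} (hp : p < N) :
    (1 - X p) * grothendieckAux N w ∈ grothendieckSpan := by
  induction w using nonInv_induction (N := N) generalizing p with
  | h w ih =>
  by_cases h : ∃ i, i + 1 < N ∧ w i < w (i + 1)
  · obtain ⟨i, hi, hlt⟩ := h
    have hfix : ∀ j, N ≤ j → (w * Equiv.swap i (i + 1)) j = j := fun j hj => by
      rw [mul_swap_succ_apply_of_ne _ (by omega) (by omega), hw j hj]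
    replace ih := fun {p} => ih i hi hlt hfix (p := p)
    rw [grothendieckAux_of_lt hi hlt]
    rcases eq_or_ne p i with rfl | h1
    · rw [← add_sub_cancel_left ((1 - X (p + 1)) * _) ((1 - X p) * _), ← isobaric_mul_right]
      exact sub_mem (isobaric_mem_span _ (ih hi)) (ih hi)
    · rcases eq_or_ne p (i + 1) with rfl | h2
      · rw [← sub_add_cancel (_ * isobaric i _) ((1 - X (i + 1)) *
          grothendieckAux N (w * Equiv.swap i (i + 1))), ← mul_sub, ← isobaric_mul_left]
        exact add_mem (isobaric_mem_span _ (ih (by omega))) (ih hi)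
      · rw [← isobaric_mul_of_ne h1 h2]
        exact isobaric_mem_span _ (ih hp)
  · rw [grothendieckAux, dif_neg h, ← stair_empty, sub_mul, one_mul,
      ← stair_insert hp.le (Finset.notMem_empty p), ← Finset.Ico_self N]
    exact sub_mem (stair_Ico_mem_span le_rfl) (stair_insert_Ico_mem_span hp le_rfl)

theorem X_mul_mem_span (p : ℕ) {f : MvPolynomial ℕ ℤ} (hf : f ∈ grothendieckSpan) :
    X p * f ∈ grothendieckSpan := by
  obtain ⟨c, rfl⟩ := hf
  induction c using Finsupp.induction_linear with
  | zero => simp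
  | add f g hf hg => rw [map_add, mul_add]; exact add_mem hf hg
  | single w a =>
    obtain ⟨N, hN⟩ := w.2
    have hN' : ∀ j, N + p + 1 ≤ j → w.1 j = j := fun j hj => hN j (by omega)
    rw [grothendieckLin_single, mul_smul_comm]
    refine Submodule.smul_mem _ _ ?_
    have h := one_sub_X_mul_grothendieckAux_mem_span hN' (p := p) (by omega)
    rw [← grothendieck_eq hN', sub_mul, one_mul] at h
    have := sub_mem (grothendieck_mem_span w) h
    rwa [sub_sub_cancel] at this

theorem grothendieckLin_surjective : Function.Surjective grothendieckLin := by
  intro f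
  change f ∈ grothendieckSpan
  induction f using MvPolynomial.induction_on with
  | C a =>
    have := grothendieckSpan.smul_mem a (grothendieck_mem_span oneSInf)
    rwa [grothendieck_one, smul_eq_C_mul, mul_one] at this
  | add p q hp hq => exact add_mem hp hq
  | mul_X p i hp => rw [mul_comm]; exact X_mul_mem_span i hp

/-- The Grothendieck polynomials form a basis of the polynomial ring. -/
noncomputable def grothendieckEquiv : (SInf →₀ ℤ) ≃ₗ[ℤ] MvPolynomial ℕ ℤ :=
  LinearEquiv.ofBijective grothendieckLin ⟨grothendieckLin_injective, grothendieckLin_surjective⟩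

theorem grothendieckEquiv_apply (c : SInf →₀ ℤ) : grothendieckEquiv c = grothendieckLin c := rfl

theorem grothendieckEquiv_symm_grothendieck (w : SInf) :
    grothendieckEquiv.symm (grothendieck w) = Finsupp.single w 1 := by
  rw [LinearEquiv.symm_apply_eq, grothendieckEquiv_apply, grothendieckLin_single, one_smul]

theorem grothendieckEquiv_symm_isobaric (i : ℕ) (f : MvPolynomial ℕ ℤ) :
    grothendieckEquiv.symm (isobaric i f) =
      Finsupp.mapDomain (demazure i) (grothendieckEquiv.symm f) := by
  rw [LinearEquiv.symm_apply_eq, grothendieckEquiv_apply, ← isobaric_grothendieckLin,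
    ← grothendieckEquiv_apply, LinearEquiv.apply_symm_apply]

theorem grothendieckEquiv_symm_one (f : MvPolynomial ℕ ℤ) :
    grothendieckEquiv.symm f oneSInf = constantCoeff f := by
  rw [← constantCoeff_grothendieckLin, ← grothendieckEquiv_apply, LinearEquiv.apply_symm_apply]

theorem isStructureConstants_iff {u v : SInf} {c : SInf →₀ ℤ} :
    IsStructureConstants u v c ↔ c = grothendieckEquiv.symm (grothendieck u * grothendieck v) := by
  rw [LinearEquiv.eq_symm_apply, eq_comm]
  rfl

open MulOpposite

/-! ### Demazure operators and the Bruhat representation -/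

variable {n : ℕ}

/-- Right Demazure action on `S_n` of the transposition of two neighbours `i < j`. -/
def finDemazure (i j : Fin n) (w : Equiv.Perm (Fin n)) : Equiv.Perm (Fin n) :=
  if w j < w i then w * Equiv.swap i j else w

/-- The operator `w ↦ w t_{ij}` if `w(j) < w(i)`, and `w ↦ 0` otherwise. -/
noncomputable def descentOp (i j : Fin n) : ZS n →ₗ[ℤ] ZS n :=
  Finsupp.linearCombination ℤ fun w =>
    (if w j < w i then (1 : ℤ) else 0) • Finsupp.single (w * Equiv.swap i j) (1 : ℤ)

theorem descentOp_single (i j : Fin n) (w : Equiv.Perm (Fin n)) :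
    descentOp i j (Finsupp.single w 1) =
      (if w j < w i then (1 : ℤ) else 0) • Finsupp.single (w * Equiv.swap i j) 1 := by
  rw [descentOp, Finsupp.linearCombination_single, one_smul]

theorem zs_hom_ext {f g : ZS n →ₗ[ℤ] ZS n}
    (h : ∀ w, f (Finsupp.single w 1) = g (Finsupp.single w 1)) : f = g :=
  Finsupp.lhom_ext' fun w => LinearMap.ext_ring (h w)

/-! ### Bruhat operators and descent operators. -/

theorem descentOp_comp_bruhatOp {i j a b a' b' : Fin n} (hab : a ≠ b) (hab' : a' ≠ b')
    (ht : Equiv.swap a b * Equiv.swap i j = Equiv.swap i j * Equiv.swap a' b')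
    (h : ∀ w : Equiv.Perm (Fin n), sgnCov w a b *
      (if (w * Equiv.swap a b) j < (w * Equiv.swap a b) i then (1 : ℤ) else 0) =
      (if w j < w i then (1 : ℤ) else 0) * sgnCov (w * Equiv.swap i j) a' b') :
    descentOp i j ∘ₗ bruhatOp a b = bruhatOp a' b' ∘ₗ descentOp i j := by
  refine zs_hom_ext fun w => ?_
  rw [LinearMap.comp_apply, LinearMap.comp_apply, bruhatOp_single w a b hab, map_smul,
    descentOp_single, smul_smul, descentOp_single, map_smul, bruhatOp_single _ a' b' hab',
    smul_smul, h w, mul_assoc, mul_assoc, ht]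

theorem swap_mul_swap_left {i j a : Fin n} (hi : a ≠ i) (hj : a ≠ j) :
    Equiv.swap a i * Equiv.swap i j = Equiv.swap i j * Equiv.swap a j := by
  ext x
  simp only [Equiv.Perm.mul_apply, Equiv.swap_apply_def]
  grind

/-- Passing `descentOp` exchanges the indices `i` and `j`. For neighbours the two covering
conditions differ only in whether one of the positions `i`, `j` lies between the others, and the
descent conditions account exactly for that. -/
theorem descentOp_bruhatOp_left {i j a : Fin n} (hij : j.val = i.val + 1) (hi : a ≠ i)
    (hj : a ≠ j) : descentOp i j ∘ₗ bruhatOp a i = bruhatOp a j ∘ₗ descentOp i j := by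
  refine descentOp_comp_bruhatOp hi hj (swap_mul_swap_left hi hj) fun w => ?_
  have hlt : i < j := by rw [Fin.lt_def]; omega
  have hadj : ∀ m : Fin n, m ≤ i ∨ j ≤ m := fun m => by rw [Fin.le_def, Fin.le_def]; omega
  obtain ⟨a1, a2, a3⟩ := swap_vals w a i
  obtain ⟨b1, b2, b3⟩ := swap_vals w i j
  have inj : ∀ x y, x ≠ y → w x ≠ w y := fun x y h1 h2 => h1 (w.injective h2)
  rcases lt_or_gt_of_ne hi with h | h
  · have h' : a < j := h.trans hlt
    simp only [sgnCov, if_pos h, if_pos h', Cov]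
    generalize (w * Equiv.swap a i) = w1 at *
    generalize (w * Equiv.swap i j) = w2 at *
    grind
  · have h' : j < a := lt_of_le_of_ne ((hadj a).resolve_left h.not_ge) hj.symm
    simp only [sgnCov, if_neg h.asymm, if_neg h'.asymm, Cov]
    generalize (w * Equiv.swap a i) = w1 at *
    generalize (w * Equiv.swap i j) = w2 at *
    grind

theorem descentOp_bruhatOp_right {i j a : Fin n} (hij : j.val = i.val + 1) (hi : a ≠ i)
    (hj : a ≠ j) : descentOp i j ∘ₗ bruhatOp a j = bruhatOp a i ∘ₗ descentOp i j := by
  have ht := swap_mul_swap_left hj hi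
  rw [Equiv.swap_comm j i] at ht
  refine descentOp_comp_bruhatOp hj hi ht fun w => ?_
  have hlt : i < j := by rw [Fin.lt_def]; omega
  have hadj : ∀ m : Fin n, m ≤ i ∨ j ≤ m := fun m => by rw [Fin.le_def, Fin.le_def]; omega
  obtain ⟨a1, a2, a3⟩ := swap_vals w a j
  obtain ⟨b1, b2, b3⟩ := swap_vals w i j
  have inj : ∀ x y, x ≠ y → w x ≠ w y := fun x y h1 h2 => h1 (w.injective h2)
  rcases lt_or_gt_of_ne hi with h | h
  · have h' : a < j := h.trans hlt
    simp only [sgnCov, if_pos h, if_pos h', Cov]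
    generalize (w * Equiv.swap a j) = w1 at *
    generalize (w * Equiv.swap i j) = w2 at *
    grind
  · have h' : j < a := lt_of_le_of_ne ((hadj a).resolve_left h.not_ge) hj.symm
    simp only [sgnCov, if_neg h.asymm, if_neg h'.asymm, Cov]
    generalize (w * Equiv.swap a j) = w1 at *
    generalize (w * Equiv.swap i j) = w2 at *
    grind

theorem cov_mul_swap_adjacent {i j a b : Fin n} (hij : j.val = i.val + 1)
    (w : Equiv.Perm (Fin n)) (hai : a ≠ i) (haj : a ≠ j) (hbi : b ≠ i) (hbj : b ≠ j) :
    Cov (w * Equiv.swap i j) a b ↔ Cov w a b := by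
  have hlt : i < j := by rw [Fin.lt_def]; omega
  have hadj : ∀ m : Fin n, m ≤ i ∨ j ≤ m := fun m => by rw [Fin.le_def, Fin.le_def]; omega
  obtain ⟨b1, b2, b3⟩ := swap_vals w i j
  have h1 : a < i ↔ a < j := ⟨fun h => h.trans hlt, fun h =>
    lt_of_le_of_ne ((hadj a).resolve_right h.not_ge) hai⟩
  have h2 : i < b ↔ j < b := ⟨fun h => lt_of_le_of_ne ((hadj b).resolve_left h.not_ge) hbj.symm,
    fun h => hlt.trans h⟩
  unfold Cov
  generalize (w * Equiv.swap i j) = w2 at *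
  rw [b3 a hai haj, b3 b hbi hbj]
  refine and_congr_right fun _ => ⟨fun h m h3 h4 => ?_, fun h m h3 h4 => ?_⟩
  · rcases eq_or_ne m i with rfl | hm
    · rw [← b2]; exact h j (h1.mp h3) (h2.mp h4)
    · rcases eq_or_ne m j with rfl | hm'
      · rw [← b1]; exact h i (h1.mpr h3) (h2.mpr h4)
      · rw [← b3 m hm hm']; exact h m h3 h4
  · rcases eq_or_ne m i with rfl | hm
    · rw [b1]; exact h j (h1.mp h3) (h2.mp h4)
    · rcases eq_or_ne m j with rfl | hm'
      · rw [b2]; exact h i (h1.mpr h3) (h2.mpr h4)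
      · rw [b3 m hm hm']; exact h m h3 h4

theorem descentOp_bruhatOp_of_ne {i j a b : Fin n} (hij : j.val = i.val + 1) (hab : a ≠ b)
    (hai : a ≠ i) (haj : a ≠ j) (hbi : b ≠ i) (hbj : b ≠ j) :
    descentOp i j ∘ₗ bruhatOp a b = bruhatOp a b ∘ₗ descentOp i j := by
  refine descentOp_comp_bruhatOp hab hab ?_ fun w => ?_
  · ext x
    simp only [Equiv.Perm.mul_apply, Equiv.swap_apply_def]
    grind
  obtain ⟨-, -, a3⟩ := swap_vals w a b
  rw [a3 i hai.symm hbi.symm, a3 j haj.symm hbj.symm, mul_comm, sgnCov, sgnCov,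
    cov_mul_swap_adjacent hij w hai haj hbi hbj, cov_mul_swap_adjacent hij w hbi hbj hai haj]

theorem bruhatOp_adjacent_single {i j : Fin n} (hij : j.val = i.val + 1)
    (w : Equiv.Perm (Fin n)) : bruhatOp i j (Finsupp.single w 1) =
      (if w i < w j then (1 : ℤ) else 0) • Finsupp.single (w * Equiv.swap i j) 1 := by
  have hlt : i < j := by rw [Fin.lt_def]; omega
  have hcov : Cov w i j ↔ w i < w j :=
    ⟨fun h => h.1, fun h => ⟨h, fun m h1 h2 => by rw [Fin.lt_def] at *; omega⟩⟩
  rw [bruhatOp_single w i j hlt.ne, sgnCov, if_pos hlt]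
  simp only [hcov]

theorem lmapDomain_finDemazure_single (i j : Fin n) (w : Equiv.Perm (Fin n)) :
    Finsupp.lmapDomain ℤ ℤ (finDemazure i j) (Finsupp.single w 1) =
      Finsupp.single (finDemazure i j w) 1 := by
  rw [Finsupp.lmapDomain_apply, Finsupp.mapDomain_single]

theorem descentOp_comp_one_add {i j : Fin n} (hij : j.val = i.val + 1) :
    descentOp i j ∘ₗ (1 + bruhatOp i j) = Finsupp.lmapDomain ℤ ℤ (finDemazure i j) := by
  have hlt : i < j := by rw [Fin.lt_def]; omega
  refine zs_hom_ext fun w => ?_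
  rw [LinearMap.comp_apply, LinearMap.add_apply, map_add, bruhatOp_adjacent_single hij,
    map_smul, Module.End.one_apply, lmapDomain_finDemazure_single, finDemazure, descentOp_single,
    descentOp_single]
  rcases lt_or_gt_of_ne (w.injective.ne hlt.ne) with h | h
  · simp [h, h.asymm, mul_assoc]
  · simp [h, h.asymm]

theorem one_add_comp_descentOp {i j : Fin n} (hij : j.val = i.val + 1) :
    1 + (1 - bruhatOp i j) ∘ₗ descentOp i j = Finsupp.lmapDomain ℤ ℤ (finDemazure i j) := by
  have hlt : i < j := by rw [Fin.lt_def]; omega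
  refine zs_hom_ext fun w => ?_
  rw [LinearMap.add_apply, LinearMap.comp_apply, Module.End.one_apply,
    lmapDomain_finDemazure_single, finDemazure, descentOp_single, map_smul, LinearMap.sub_apply,
    bruhatOp_adjacent_single hij, Module.End.one_apply]
  rcases lt_or_gt_of_ne (w.injective.ne hlt.ne) with h | h
  · simp [h.asymm]
  · simp [h, mul_assoc]

/-- The operator of `[ij]`, as an element of the algebra in which factors act from left to
right. -/
noncomputable abbrev brOp (i j : Fin n) : (Module.End ℤ (ZS n))ᵐᵒᵖ := op (bruhatOp i j)

/-- The Demazure operator, as an element of the algebra in which factors act from left to right. -/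
noncomputable abbrev demOp (i j : Fin n) : (Module.End ℤ (ZS n))ᵐᵒᵖ :=
  op (Finsupp.lmapDomain ℤ ℤ (finDemazure i j))

/-! ### The relations of the quadratic algebra, with factors acting from left to right. -/

theorem bruhat_bracket {i j : Fin n} (h : i ≠ j) : bruhat n (bracket i j) = brOp i j := by
  rw [bracket, dif_pos h, bruhat, RingQuot.liftAlgHom_mkAlgHom_apply, freeGen,
    FreeAlgebra.lift_ι_apply]

theorem brOp_antisymm {i j : Fin n} (h : i ≠ j) : brOp j i = - brOp i j := by
  rw [eq_neg_iff_add_eq_zero, ← op_add, bruhat_antisymm j i h.symm, op_zero]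

theorem brOp_square {i j : Fin n} (h : i ≠ j) : brOp i j * brOp i j = 0 := by
  rw [← op_mul, Module.End.mul_eq_comp, bruhat_square i j h, op_zero]

theorem brOp_triangle {i j k : Fin n} (hij : i ≠ j) (hjk : j ≠ k) (hki : k ≠ i) :
    brOp i j * brOp j k + brOp j k * brOp k i + brOp k i * brOp i j = 0 := by
  rw [← op_mul, ← op_mul, ← op_mul, ← op_add, ← op_add]
  exact congrArg op (bruhat_triangle i j k hij hjk hki)

theorem brOp_comm {i j k l : Fin n} (hij : i ≠ j) (hkl : k ≠ l)
    (hik : i ≠ k) (hil : i ≠ l) (hjk : j ≠ k) (hjl : j ≠ l) :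
    brOp i j * brOp k l = brOp k l * brOp i j :=
  congrArg op (bruhat_comm i j k l hij hkl hik hil hjk hjl)

/-- With `x = [ip]`, `y = [jp]`, `b = [ij]` the hypotheses are two triangle relations. They match
the quadratic terms, and with `b² = 0` they turn both cubic terms into `b x b`. -/
theorem yangBaxter_of_relations {R : Type*} [Ring R] {x y b : R} (hb : b * b = 0)
    (h1 : b * y = y * x + x * b) (h2 : y * b = b * x + x * y) :
    (1 + x) * (1 + y) * (1 - b) = (1 - b) * (1 + y) * (1 + x) := by
  have c1 : x * y * b = - (b * x * b) := by
    rw [eq_sub_of_add_eq' h2.symm, sub_mul, mul_assoc y, hb, mul_zero, zero_sub]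
  have c2 : b * y * x = - (b * x * b) := by
    rw [mul_assoc, eq_sub_of_add_eq h1.symm, mul_sub, ← mul_assoc b b, hb, zero_mul, zero_sub,
      mul_assoc]
  have e1 : (1 + x) * (1 + y) * (1 - b) = 1 + x + y + x * y - b - x * b - y * b - x * y * b := by
    noncomm_ring
  have e2 : (1 - b) * (1 + y) * (1 + x) = 1 + x + y + y * x - b - b * x - b * y - b * y * x := by
    noncomm_ring
  rw [e1, e2, c1, c2, h1, h2]
  abel

/-- Passing `d` exchanges `x` and `y`, and passing `b` restores their order. It is used with `d` the
descent operator and `b = 1 - [ij]`, for which `1 + d b` is the Demazure operator. -/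
theorem commute_of_yangBaxter {R : Type*} [Ring R] {x y b d : R} (hx : x * d = d * y)
    (hy : y * d = d * x) (h : x * y * b = b * y * x) : Commute (y * x) (1 + d * b) := by
  have e : y * x * (d * b) = d * b * (y * x) := by
    rw [mul_assoc y, ← mul_assoc x, hx, mul_assoc d, ← mul_assoc y, hy, mul_assoc d, ← mul_assoc x,
      h, mul_assoc, mul_assoc]
  rw [Commute, SemiconjBy, mul_add, mul_one, add_mul, one_mul, e]

theorem brOp_yangBaxter {i j p : Fin n} (hij : i ≠ j) (hpi : p ≠ i) (hpj : p ≠ j) :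
    (1 + brOp i p) * (1 + brOp j p) * (1 - brOp i j) =
      (1 - brOp i j) * (1 + brOp j p) * (1 + brOp i p) := by
  have t1 := brOp_triangle hij hpj.symm hpi
  have t2 := brOp_triangle hij.symm hpi.symm hpj
  rw [brOp_antisymm hpi.symm] at t1
  rw [brOp_antisymm hpj.symm, brOp_antisymm hij] at t2
  refine yangBaxter_of_relations (brOp_square hij) ?_ ?_
  · rw [← sub_eq_zero, ← t1]; noncomm_ring
  · rw [← sub_eq_zero, ← t2]; noncomm_ring

/-- The operator of `1 - κ_p`. -/
noncomputable def dunklOp (p : Fin n) : (Module.End ℤ (ZS n))ᵐᵒᵖ := bruhat n (1 - kappa p)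

theorem dunklOp_eq (p : Fin n) :
    dunklOp p = ((((List.finRange n).filter (· < p)).reverse ++
      ((List.finRange n).filter (p < ·)).reverse).map fun i => 1 + brOp i p).prod := by
  rw [dunklOp, kappa, sub_sub_cancel, map_list_prod, List.map_map]
  congr 1
  refine List.map_congr_left fun i hi => ?_
  have hip : i ≠ p := by
    simp only [List.mem_append, List.mem_reverse, List.mem_filter, decide_eq_true_eq] at hi
    rcases hi with h | h
    · exact h.2.ne
    · exact h.2.ne'
  rw [Function.comp, map_add, map_one, bruhat_bracket hip]

/-! ### Commutation of Dunkl and Demazure operators. -/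

theorem finRange_eq_append {i j : Fin n} (hij : j.val = i.val + 1) :
    ∃ l l' : List (Fin n), List.finRange n = l ++ i :: j :: l' ∧ (∀ a ∈ l, a < i) ∧
      ∀ a ∈ l', j < a := by
  have h : List.finRange n =
      (List.finRange n).take i ++ i :: j :: (List.finRange n).drop (i + 2) := by
    conv_lhs => rw [← List.take_append_drop i (List.finRange n)]
    rw [List.drop_eq_getElem_cons (by simp), List.drop_eq_getElem_cons (by simp; omega)]
    simp only [List.getElem_finRange]
    simp only [Fin.ext_iff, Fin.val_cast, List.append_cancel_left_eq, List.cons.injEq, hij,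
      and_true]
  have hp := List.pairwise_lt_finRange n
  rw [h, List.pairwise_append, List.pairwise_cons, List.pairwise_cons] at hp
  exact ⟨_, _, h, fun a ha => hp.2.2 a ha i (by simp), hp.2.1.2.1⟩

theorem list_prod_mul_comm {R α : Type*} [Monoid R] {d : R} {f g : α → R} {l : List α}
    (h : ∀ a ∈ l, f a * d = d * g a) : (l.map f).prod * d = d * (l.map g).prod := by
  induction l with
  | nil => simp
  | cons a l ih =>
    rw [List.map_cons, List.map_cons, List.prod_cons, List.prod_cons, mul_assoc,
      ih fun b hb => h b (by simp [hb]), ← mul_assoc, h a (by simp), mul_assoc]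

/-- The element of the opposite algebra that corresponds to `descentOp`. -/
noncomputable abbrev desOp (i j : Fin n) : (Module.End ℤ (ZS n))ᵐᵒᵖ := op (descentOp i j)

theorem one_add_mul_desOp {i j : Fin n} (hij : j.val = i.val + 1) :
    (1 + brOp i j) * desOp i j = demOp i j :=
  congrArg op (descentOp_comp_one_add hij)

theorem one_add_desOp_mul {i j : Fin n} (hij : j.val = i.val + 1) :
    1 + desOp i j * (1 - brOp i j) = demOp i j :=
  congrArg op (one_add_comp_descentOp hij)

theorem one_add_brOp_left_mul {i j a : Fin n} (hij : j.val = i.val + 1) (hi : a ≠ i)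
    (hj : a ≠ j) : (1 + brOp a i) * desOp i j = desOp i j * (1 + brOp a j) := by
  have : brOp a i * desOp i j = desOp i j * brOp a j :=
    congrArg op (descentOp_bruhatOp_left hij hi hj)
  rw [add_mul, mul_add, one_mul, mul_one, this]

theorem one_add_brOp_right_mul {i j a : Fin n} (hij : j.val = i.val + 1) (hi : a ≠ i)
    (hj : a ≠ j) : (1 + brOp a j) * desOp i j = desOp i j * (1 + brOp a i) := by
  have : brOp a j * desOp i j = desOp i j * brOp a i :=
    congrArg op (descentOp_bruhatOp_right hij hi hj)
  rw [add_mul, mul_add, one_mul, mul_one, this]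

theorem one_add_brOp_mul_demOp {i j a b : Fin n} (hij : j.val = i.val + 1) (hab : a ≠ b)
    (hai : a ≠ i) (haj : a ≠ j) (hbi : b ≠ i) (hbj : b ≠ j) :
    (1 + brOp a b) * demOp i j = demOp i j * (1 + brOp a b) := by
  have hne : i ≠ j := fun h => by rw [h] at hij; omega
  have h1 : Commute (brOp a b) (desOp i j) :=
    congrArg op (descentOp_bruhatOp_of_ne hij hab hai haj hbi hbj)
  have h2 : Commute (brOp a b) (brOp i j) := brOp_comm hab hne hai haj hbi hbj
  rw [← one_add_desOp_mul hij]
  exact ((Commute.one_left _).add_left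
    ((Commute.one_right _).add_right (h1.mul_right ((Commute.one_right _).sub_right h2)))).eq

theorem one_sub_mul_demOp {i j : Fin n} (hij : j.val = i.val + 1) :
    (1 - brOp i j) * demOp i j = desOp i j := by
  have hne : i ≠ j := fun h => by rw [h] at hij; omega
  have h : (1 - brOp i j) * (1 + brOp i j) = 1 - brOp i j * brOp i j := by noncomm_ring
  rw [← one_add_mul_desOp hij, ← mul_assoc, h, brOp_square hne, sub_zero, one_mul]

theorem demOp_sub_one_mul {i j : Fin n} (hij : j.val = i.val + 1) :
    (demOp i j - 1) * (1 + brOp i j) = desOp i j := by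
  have hne : i ≠ j := fun h => by rw [h] at hij; omega
  have h : (1 - brOp i j) * (1 + brOp i j) = 1 - brOp i j * brOp i j := by noncomm_ring
  rw [← one_add_desOp_mul hij, add_sub_cancel_left, mul_assoc, h, brOp_square hne, sub_zero,
    mul_one]

/-- The factors of `1 - κ_p` run cyclically downwards from `p`. For neighbours `i`, `j` the factor
of `j` is the last one for `i` and the factor of `i` is the first one for `j`; the same list remains
in both products. -/
theorem exists_dunklOp_adjacent {i j : Fin n} (hij : j.val = i.val + 1) :
    ∃ l : List (Fin n), (∀ a ∈ l, a ≠ i ∧ a ≠ j) ∧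
      dunklOp i = (l.map fun a => 1 + brOp a i).prod * (1 - brOp i j) ∧
      dunklOp j = (1 + brOp i j) * (l.map fun a => 1 + brOp a j).prod := by
  obtain ⟨l, l', h, hl, hl'⟩ := finRange_eq_append hij
  have hlt : i < j := by rw [Fin.lt_def]; omega
  have f1 : l.filter (· < i) = l := List.filter_eq_self.mpr fun a ha => by simpa using hl a ha
  have f2 : l.filter (· < j) = l :=
    List.filter_eq_self.mpr fun a ha => by simpa using (hl a ha).trans hlt
  have f3 : l.filter (i < ·) = [] :=
    List.filter_eq_nil_iff.mpr fun a ha => by simpa using (hl a ha).le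
  have f4 : l.filter (j < ·) = [] :=
    List.filter_eq_nil_iff.mpr fun a ha => by simpa using ((hl a ha).trans hlt).le
  have g1 : l'.filter (· < i) = [] :=
    List.filter_eq_nil_iff.mpr fun a ha => by simpa using (hlt.trans (hl' a ha)).le
  have g2 : l'.filter (· < j) = [] :=
    List.filter_eq_nil_iff.mpr fun a ha => by simpa using (hl' a ha).le
  have g3 : l'.filter (i < ·) = l' :=
    List.filter_eq_self.mpr fun a ha => by simpa using hlt.trans (hl' a ha)
  have g4 : l'.filter (j < ·) = l' := List.filter_eq_self.mpr fun a ha => by simpa using hl' a ha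
  refine ⟨l.reverse ++ l'.reverse, fun a ha => ?_, ?_, ?_⟩
  · rw [List.mem_append, List.mem_reverse, List.mem_reverse] at ha
    rcases ha with ha | ha
    · exact ⟨(hl a ha).ne, ((hl a ha).trans hlt).ne⟩
    · exact ⟨(hlt.trans (hl' a ha)).ne', (hl' a ha).ne'⟩
  · rw [dunklOp_eq, h]
    simp [List.filter_append, f1, f3, g1, g3, hlt, hlt.asymm,
      brOp_antisymm hlt.ne, sub_eq_add_neg, mul_assoc]
  · rw [dunklOp_eq, h]
    simp [List.filter_append, f2, f4, g2, g4, hlt, hlt.asymm]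

/-- Both sides equal the descent operator times the product of `1 + [aj]` over the common list. This
is the counterpart of `isobaric_mul_left`, as `dunklOp_right_mul_demOp` is of `isobaric_mul_right`.
-/
theorem dunklOp_left_mul_demOp {i j : Fin n} (hij : j.val = i.val + 1) :
    dunklOp i * demOp i j = (demOp i j - 1) * dunklOp j := by
  obtain ⟨l, hl, h1, h2⟩ := exists_dunklOp_adjacent hij
  rw [h1, h2, mul_assoc, one_sub_mul_demOp hij, ← mul_assoc, demOp_sub_one_mul hij]
  exact list_prod_mul_comm fun a ha => one_add_brOp_left_mul hij (hl a ha).1 (hl a ha).2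

theorem dunklOp_right_mul_demOp {i j : Fin n} (hij : j.val = i.val + 1) :
    dunklOp j * demOp i j = dunklOp j + demOp i j * dunklOp i := by
  obtain ⟨l, hl, h1, h2⟩ := exists_dunklOp_adjacent hij
  have h3 : (l.map fun a => 1 + brOp a j).prod * desOp i j =
      desOp i j * (l.map fun a => 1 + brOp a i).prod :=
    list_prod_mul_comm fun a ha => one_add_brOp_right_mul hij (hl a ha).1 (hl a ha).2
  conv_lhs => rw [← one_add_desOp_mul hij, mul_add, mul_one, h2, ← mul_assoc,
    mul_assoc _ _ (desOp i j), h3, ← mul_assoc, one_add_mul_desOp hij, mul_assoc, ← h1, ← h2]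

theorem exists_dunklOp_of_ne {i j p : Fin n} (hij : j.val = i.val + 1) (hpi : p ≠ i)
    (hpj : p ≠ j) : ∃ l l' : List (Fin n), (∀ a ∈ l, a ≠ i ∧ a ≠ j ∧ a ≠ p) ∧
      (∀ a ∈ l', a ≠ i ∧ a ≠ j ∧ a ≠ p) ∧
      dunklOp p = (l.map fun a => 1 + brOp a p).prod *
        ((1 + brOp j p) * (1 + brOp i p) * (l'.map fun a => 1 + brOp a p).prod) := by
  obtain ⟨l, l', h, hl, hl'⟩ := finRange_eq_append hij
  have hlt : i < j := by rw [Fin.lt_def]; omega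
  have hl2 : ∀ a ∈ l, a ≠ i ∧ a ≠ j := fun a ha => ⟨(hl a ha).ne, ((hl a ha).trans hlt).ne⟩
  have hl2' : ∀ a ∈ l', a ≠ i ∧ a ≠ j := fun a ha =>
    ⟨(hlt.trans (hl' a ha)).ne', (hl' a ha).ne'⟩
  have hmem : ∀ m : List (Fin n), (∀ a ∈ m, (a ∈ l ∨ a ∈ l') ∧ (a < p ∨ p < a)) → ∀ {a : Fin n},
      a ∈ m → a ≠ i ∧ a ≠ j ∧ a ≠ p := fun m hm a ha => by
    obtain ⟨h1, h2⟩ := hm a ha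
    exact ⟨h1.elim (fun h => (hl2 a h).1) fun h => (hl2' a h).1,
      h1.elim (fun h => (hl2 a h).2) fun h => (hl2' a h).2, h2.elim ne_of_lt ne_of_gt⟩
  rcases lt_or_gt_of_ne hpi with hp | hp
  · have hp' : p < j := hp.trans hlt
    -- In the cyclic descending order the factor of `j` is immediately followed by that of `i`; the
    -- lists collect what stands before and after this pair.
    refine ⟨(l'.filter (· < p)).reverse ++ (l.filter (· < p)).reverse ++
      (l'.filter (p < ·)).reverse, (l.filter (p < ·)).reverse, fun a ha => ?_, fun a ha => ?_, ?_⟩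
    · exact hmem _ (by simp only [List.mem_append, List.mem_reverse, List.mem_filter,
        decide_eq_true_eq]; tauto) ha
    · exact hmem _ (by simp only [List.mem_reverse, List.mem_filter,
        decide_eq_true_eq]; tauto) ha
    · rw [dunklOp_eq, h]
      simp [List.filter_append, hp, hp', hp.asymm, hp'.asymm, mul_assoc]
  · have hp' : j < p := by rw [Fin.lt_def] at *; omega
    refine ⟨(l'.filter (· < p)).reverse,
      (l.filter (· < p)).reverse ++ (l'.filter (p < ·)).reverse ++
      (l.filter (p < ·)).reverse, fun a ha => ?_, fun a ha => ?_, ?_⟩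
    · exact hmem _ (by simp only [List.mem_reverse, List.mem_filter,
        decide_eq_true_eq]; tauto) ha
    · exact hmem _ (by simp only [List.mem_append, List.mem_reverse, List.mem_filter,
        decide_eq_true_eq]; tauto) ha
    · rw [dunklOp_eq, h]
      simp [List.filter_append, hp, hp', hp.asymm, hp'.asymm, mul_assoc]

/-- The factors indexed by `a ≠ i, j` commute with the Demazure operator because their indices are
disjoint from `i, j`; the remaining adjacent pair commutes as a block, by the Yang–Baxter relation.
-/
theorem dunklOp_mul_demOp_of_ne {i j p : Fin n} (hij : j.val = i.val + 1) (hpi : p ≠ i)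
    (hpj : p ≠ j) : dunklOp p * demOp i j = demOp i j * dunklOp p := by
  have hne : i ≠ j := fun h => by rw [h] at hij; omega
  obtain ⟨l, l', hl, hl', h⟩ := exists_dunklOp_of_ne hij hpi hpj
  have c1 : Commute (l.map fun a => 1 + brOp a p).prod (demOp i j) :=
    list_prod_mul_comm fun a ha => one_add_brOp_mul_demOp hij (hl a ha).2.2 (hl a ha).1
      (hl a ha).2.1 hpi hpj
  have c2 : Commute (l'.map fun a => 1 + brOp a p).prod (demOp i j) :=
    list_prod_mul_comm fun a ha => one_add_brOp_mul_demOp hij (hl' a ha).2.2 (hl' a ha).1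
      (hl' a ha).2.1 hpi hpj
  have neg_mul_desOp : ∀ a b, brOp p a * desOp i j = desOp i j * brOp p b → p ≠ a → p ≠ b →
      (1 + brOp a p) * desOp i j = desOp i j * (1 + brOp b p) := fun a b e ha hb => by
    rw [brOp_antisymm ha, brOp_antisymm hb, add_mul, mul_add, neg_mul, mul_neg, e, one_mul, mul_one]
  have c3 : Commute ((1 + brOp j p) * (1 + brOp i p)) (demOp i j) := by
    rw [← one_add_desOp_mul hij]
    exact commute_of_yangBaxter
      (neg_mul_desOp i j (congrArg op (descentOp_bruhatOp_left hij hpi hpj)) hpi hpj)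
      (neg_mul_desOp j i (congrArg op (descentOp_bruhatOp_right hij hpi hpj)) hpj hpi)
      (brOp_yangBaxter hne hpi hpj)
  rw [h]
  exact (c1.mul_left (Commute.mul_left c3 c2)).eq

/-! ### Truncation to `S_n` -/

theorem toSInf_apply (w : Equiv.Perm (Fin n)) (a : Fin n) : (toSInf w).1 a.val = (w a).val :=
  Equiv.Perm.extendDomain_apply_image w Fin.equivSubtype a

theorem toSInf_fixed (w : Equiv.Perm (Fin n)) (i : ℕ) (hi : n ≤ i) : (toSInf w).1 i = i :=
  Equiv.Perm.extendDomain_apply_not_subtype _ _ (not_lt.mpr hi)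

theorem toSInf_injective : Function.Injective (toSInf (n := n)) := fun v w h =>
  Equiv.ext fun a => Fin.ext <| by rw [← toSInf_apply, ← toSInf_apply, h]

theorem toSInf_one : toSInf (1 : Equiv.Perm (Fin n)) = oneSInf := by
  refine Subtype.ext (Equiv.ext fun k => ?_)
  by_cases hk : k < n
  · exact toSInf_apply 1 ⟨k, hk⟩
  · exact toSInf_fixed 1 k (not_lt.mp hk)

theorem toSInf_mul_swap {i j : Fin n} (hij : j.val = i.val + 1) (w : Equiv.Perm (Fin n)) :
    toSInf (w * Equiv.swap i j) = mulSwap i (toSInf w) := by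
  refine Subtype.ext (Equiv.ext fun k => ?_)
  change _ = (toSInf w).1 (Equiv.swap i.val (i.val + 1) k)
  by_cases hk : k < n
  · lift k to Fin n using hk
    have h : Equiv.swap i.val (i.val + 1) k.val = (Equiv.swap i j k).val := by
      rw [← hij, Equiv.swap_apply_def, Equiv.swap_apply_def]
      simp only [Fin.ext_iff]
      split_ifs <;> rfl
    rw [toSInf_apply, h, toSInf_apply, Equiv.Perm.mul_apply]
  · rw [toSInf_fixed _ k (not_lt.mp hk), Equiv.swap_apply_of_ne_of_ne (by omega) (by omega),
      toSInf_fixed _ k (not_lt.mp hk)]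

theorem toSInf_lt_iff {i j : Fin n} (hij : j.val = i.val + 1) (w : Equiv.Perm (Fin n)) :
    (toSInf w).1 (i.val + 1) < (toSInf w).1 i.val ↔ w j < w i := by
  rw [← hij, toSInf_apply, toSInf_apply, Fin.lt_def]

theorem toSInf_finDemazure {i j : Fin n} (hij : j.val = i.val + 1) (w : Equiv.Perm (Fin n)) :
    toSInf (finDemazure i j w) = demazure i (toSInf w) := by
  rw [finDemazure, demazure, apply_ite toSInf, toSInf_mul_swap hij]
  simp only [toSInf_lt_iff hij]

theorem mem_range_toSInf_of_demazure {i j : Fin n} (hij : j.val = i.val + 1) {v : SInf}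
    (h : demazure i v ∈ Set.range (toSInf (n := n))) : v ∈ Set.range (toSInf (n := n)) := by
  obtain ⟨w, hw⟩ := h
  rw [demazure] at hw
  split_ifs at hw
  · exact ⟨w * Equiv.swap i j, by rw [toSInf_mul_swap hij, hw, mulSwap_mulSwap]⟩
  · exact ⟨w, hw⟩

/-- The projection `ℤ⟨S_∞⟩ → ℤ⟨S_n⟩` that forgets the coefficients outside `S_n`. -/
noncomputable def trunc (n : ℕ) : (SInf →₀ ℤ) →ₗ[ℤ] ZS n :=
  Finsupp.lcomapDomain toSInf toSInf_injective

theorem trunc_apply (c : SInf →₀ ℤ) (w : Equiv.Perm (Fin n)) : trunc n c w = c (toSInf w) := rfl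

theorem trunc_single_toSInf (w : Equiv.Perm (Fin n)) (a : ℤ) :
    trunc n (Finsupp.single (toSInf w) a) = Finsupp.single w a := by
  classical
  ext v
  rw [trunc_apply, Finsupp.single_apply, Finsupp.single_apply]
  simp only [toSInf_injective.eq_iff]

theorem trunc_single_of_notMem {v : SInf} (h : v ∉ Set.range (toSInf (n := n))) (a : ℤ) :
    trunc n (Finsupp.single v a) = 0 := by
  classical
  ext w
  rw [trunc_apply, Finsupp.single_apply, if_neg fun e => h ⟨w, e.symm⟩]
  rfl

/-- Demazure operators at positions inside `S_n` preserve both `S_n` and its complement, so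
forgetting the complement is compatible with them. -/
theorem trunc_mapDomain_demazure {i j : Fin n} (hij : j.val = i.val + 1) (c : SInf →₀ ℤ) :
    trunc n (Finsupp.mapDomain (demazure i) c) =
      Finsupp.mapDomain (finDemazure i j) (trunc n c) := by
  induction c using Finsupp.induction_linear with
  | zero => simp
  | add f g hf hg => rw [Finsupp.mapDomain_add, map_add, map_add, hf, hg, Finsupp.mapDomain_add]
  | single v a =>
    rw [Finsupp.mapDomain_single]
    by_cases h : v ∈ Set.range (toSInf (n := n))
    · obtain ⟨w, rfl⟩ := h
      rw [← toSInf_finDemazure hij, trunc_single_toSInf, trunc_single_toSInf,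
        Finsupp.mapDomain_single]
    · rw [trunc_single_of_notMem h, Finsupp.mapDomain_zero,
        trunc_single_of_notMem (mt (mem_range_toSInf_of_demazure hij) h)]

theorem finDemazure_eq_iff {i j : Fin n} {w : Equiv.Perm (Fin n)} (h : w j < w i)
    (v : Equiv.Perm (Fin n)) :
    finDemazure i j v = w * Equiv.swap i j ↔ v = w ∨ v = w * Equiv.swap i j := by
  constructor
  · intro e
    rw [finDemazure] at e
    split_ifs at e
    · exact Or.inl (mul_right_cancel e)
    · exact Or.inr e
  · rintro (rfl | rfl)
    · rw [finDemazure, if_pos h]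
    · rw [finDemazure, if_neg]
      simpa using h.le

theorem perm_fin_induction {P : Equiv.Perm (Fin n) → Prop} (one : P 1)
    (step : ∀ w (i j : Fin n), j.val = i.val + 1 → w j < w i → P (w * Equiv.swap i j) → P w)
    (w : Equiv.Perm (Fin n)) : P w := by
  have key : ∀ v : SInf, ∀ w : Equiv.Perm (Fin n), toSInf w = v → P w := by
    refine sInf_induction (fun w hw => ?_) fun v i hi ih w hw => ?_
    · rw [← toSInf_one (n := n)] at hw
      exact toSInf_injective hw ▸ one
    · subst hw
      have hin : i + 1 < n := by
        by_contra! hc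
        exact (lt_succ_of_fixed (toSInf_fixed w) hc).asymm hi
      have hij : (⟨i + 1, hin⟩ : Fin n).val = (⟨i, by omega⟩ : Fin n).val + 1 := rfl
      exact step w ⟨i, by omega⟩ ⟨i + 1, hin⟩ hij ((toSInf_lt_iff hij w).mp hi)
        (ih _ (toSInf_mul_swap hij w))
  exact key _ w rfl

/-- The part in `ℤ⟨S_n⟩` of the expansion of a polynomial into Grothendieck polynomials. -/
noncomputable def expansion (n : ℕ) : MvPolynomial ℕ ℤ →ₗ[ℤ] ZS n :=
  trunc n ∘ₗ grothendieckEquiv.symm.toLinearMap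

theorem expansion_apply (f : MvPolynomial ℕ ℤ) (w : Equiv.Perm (Fin n)) :
    expansion n f w = grothendieckEquiv.symm f (toSInf w) := rfl

theorem expansion_grothendieck (w : Equiv.Perm (Fin n)) :
    expansion n (grothendieck (toSInf w)) = Finsupp.single w 1 := by
  rw [expansion, LinearMap.comp_apply, LinearEquiv.coe_coe, grothendieckEquiv_symm_grothendieck,
    trunc_single_toSInf]

theorem expansion_one (f : MvPolynomial ℕ ℤ) : expansion n f 1 = constantCoeff f := by
  rw [expansion_apply, toSInf_one, grothendieckEquiv_symm_one]

theorem expansion_isobaric {i j : Fin n} (hij : j.val = i.val + 1) (f : MvPolynomial ℕ ℤ) :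
    expansion n (isobaric i f) = (demOp i j).unop (expansion n f) := by
  change trunc n (grothendieckEquiv.symm (isobaric i f)) = _
  rw [grothendieckEquiv_symm_isobaric, trunc_mapDomain_demazure hij]
  rfl

/-! ### Multiplication by a variable -/

/-- The only candidate that `[ap]` could move to the identity is the transposition of `a` and `p`,
and that step would lower the length. -/
theorem bruhatOp_apply_one {a p : Fin n} (h : a ≠ p) (c : ZS n) : bruhatOp a p c 1 = 0 := by
  classical
  induction c using Finsupp.induction_linear with
  | zero => simp
  | add f g hf hg => rw [map_add, Finsupp.add_apply, hf, hg, add_zero]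
  | single w b =>
    rw [← mul_one b, ← smul_eq_mul, ← Finsupp.smul_single, map_smul, bruhatOp_single w a p h,
      Finsupp.smul_apply, Finsupp.smul_apply, Finsupp.single_apply]
    split_ifs with e
    · have hw : w = Equiv.swap a p := by
        rw [← mul_one w, ← Equiv.swap_mul_self a p, ← mul_assoc, e, one_mul]
      have hs : sgnCov w a p = 0 := by
        rw [sgnCov, hw]
        split_ifs with h1 h2 h2
        · exact absurd h2.1 (by simpa using h1.le)
        · rfl
        · exact absurd h2.1 (by simpa using not_lt.mp h1)
        · rfl
      rw [hs, zero_smul, smul_zero]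
    · simp

theorem dunklOp_apply_one (p : Fin n) (c : ZS n) : (dunklOp p).unop c 1 = c 1 := by
  have key : ∀ l : List (Fin n), (∀ a ∈ l, a ≠ p) → ∀ c : ZS n,
      ((l.map fun a => 1 + brOp a p).prod).unop c 1 = c 1 := by
    intro l
    induction l with
    | nil => intro _ c; rfl
    | cons a l ih =>
      intro hl c
      rw [List.map_cons, List.prod_cons, unop_mul, Module.End.mul_apply,
        ih fun b hb => hl b (by simp [hb])]
      change (c + bruhatOp a p c) 1 = c 1
      rw [Finsupp.add_apply, bruhatOp_apply_one (hl a (by simp)), add_zero]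
  rw [dunklOp_eq]
  refine key _ (fun a ha => ?_) c
  simp only [List.mem_append, List.mem_reverse, List.mem_filter, decide_eq_true_eq] at ha
  exact ha.elim (fun h => h.2.ne) fun h => h.2.ne'

/-- The defect of `1 - κ_p` acting as multiplication by `1 - x_p`. -/
noncomputable def dunklDefect (p : Fin n) (f : MvPolynomial ℕ ℤ) : ZS n :=
  expansion n ((1 - X p.val) * f) - (dunklOp p).unop (expansion n f)

/-- Since `1 - x_p` and `1 - κ_p` satisfy the same commutation rules, a Demazure operator turns a
defect into a defect, or for `p = j` into a sum of two: those of `j` at `f` and of `i` at `π_i f`.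
-/
theorem demOp_dunklDefect_mem_span {i j : Fin n} (hij : j.val = i.val + 1) (p : Fin n)
    (f : MvPolynomial ℕ ℤ) :
    (demOp i j).unop (dunklDefect p f) ∈
      Submodule.span ℤ (Set.range fun q : Fin n × MvPolynomial ℕ ℤ => dunklDefect q.1 q.2) := by
  have hmem : ∀ p f, dunklDefect p f ∈
      Submodule.span ℤ (Set.range fun q : Fin n × MvPolynomial ℕ ℤ => dunklDefect q.1 q.2) :=
    fun p f => Submodule.subset_span ⟨(p, f), rfl⟩
  have h0 : (demOp i j).unop (dunklDefect p f) = expansion n (isobaric i ((1 - X p.val) * f)) -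
      (dunklOp p * demOp i j).unop (expansion n f) := by
    rw [dunklDefect, map_sub, ← expansion_isobaric hij]
    rfl
  rw [h0]
  rcases eq_or_ne p i with rfl | hpi
  · rw [isobaric_mul_left, ← hij, dunklOp_left_mul_demOp hij, unop_mul, Module.End.mul_apply,
      unop_sub, LinearMap.sub_apply, ← expansion_isobaric hij, unop_one, Module.End.one_apply,
      ← map_sub (expansion n)]
    exact hmem j _
  · rcases eq_or_ne p j with rfl | hpj
    · rw [hij, isobaric_mul_right, ← hij, dunklOp_right_mul_demOp hij, unop_add, unop_mul,
        LinearMap.add_apply, Module.End.mul_apply, ← expansion_isobaric hij, map_add,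
        add_sub_add_comm]
      exact add_mem (hmem p f) (hmem i _)
    · rw [isobaric_mul_of_ne (fun h => hpi (Fin.ext h)) (fun h => hpj (Fin.ext (h.trans hij.symm))),
        dunklOp_mul_demOp_of_ne hij hpi hpj, unop_mul, Module.End.mul_apply,
        ← expansion_isobaric hij]
      exact hmem p _

theorem dunklDefect_eq_zero (p : Fin n) (f : MvPolynomial ℕ ℤ) : dunklDefect p f = 0 := by
  refine eq_zero_of_stable
    (d := fun q : {q : Fin n × Fin n // q.2.val = q.1.val + 1} => finDemazure q.1.1 q.1.2) (e := 1)
    (K := Submodule.span ℤ (Set.range fun q : Fin n × MvPolynomial ℕ ℤ => dunklDefect q.1 q.2))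
    ?_ ?_ ?_ (Submodule.subset_span ⟨(p, f), rfl⟩)
  · refine fun P h1 h2 => perm_fin_induction h1 fun w i j hij hlt =>
      h2 w ⟨(i, j), hij⟩ _ (fun e => ?_) (finDemazure_eq_iff hlt)
    have := Equiv.congr_fun e i
    rw [Equiv.Perm.mul_apply, Equiv.swap_apply_left] at this
    exact hlt.ne this
  · rintro ⟨⟨i, j⟩, hij⟩ c hc
    change (demOp i j).unop c ∈ _
    induction hc using Submodule.span_induction with
    | mem x hx =>
      obtain ⟨q, rfl⟩ := hx
      exact demOp_dunklDefect_mem_span hij q.1 q.2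
    | zero => rw [map_zero]; exact zero_mem _
    | add x y _ _ hx hy => rw [map_add]; exact add_mem hx hy
    | smul a x _ hx => rw [map_smul]; exact Submodule.smul_mem _ a hx
  · intro c hc
    induction hc using Submodule.span_induction with
    | mem x hx =>
      obtain ⟨q, rfl⟩ := hx
      simp [dunklDefect, dunklOp_apply_one, expansion_one]
    | zero => rfl
    | add x y _ _ hx hy => rw [Finsupp.add_apply, hx, hy, add_zero]
    | smul a x _ hx => rw [Finsupp.smul_apply, hx, smul_zero]

/-- The `K`-theoretic Monk formula: `κ_p` acts as multiplication by `x_p`. -/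
theorem expansion_X_mul (p : Fin n) (f : MvPolynomial ℕ ℤ) :
    expansion n (X p.val * f) = (bruhat n (kappa p)).unop (expansion n f) := by
  have h := dunklDefect_eq_zero p f
  rw [dunklDefect, dunklOp, map_sub, map_one, unop_sub, unop_one, LinearMap.sub_apply,
    Module.End.one_apply, sub_mul, one_mul, map_sub, sub_sub_sub_cancel_left, sub_eq_zero] at h
  exact h.symm

/-! ### Evaluation of polynomials at the Dunkl elements -/

theorem expansion_X_pow_mul (p : Fin n) (k : ℕ) (f : MvPolynomial ℕ ℤ) :
    expansion n (X p.val ^ k * f) = (bruhat n (kappa p ^ k)).unop (expansion n f) := by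
  induction k with
  | zero => simp
  | succ k ih =>
    rw [pow_succ', mul_assoc, expansion_X_mul, ih, pow_succ, map_mul, unop_mul,
      Module.End.mul_apply]

theorem expansion_list_prod_mul {a : ℕ → QuadAlg n} {l : List ℕ}
    (ha : ∀ i ∈ l, ∃ p : Fin n, p.val = i ∧ a i = kappa p) (m : ℕ → ℕ) (f : MvPolynomial ℕ ℤ) :
    expansion n ((l.map fun i => X i ^ m i).prod * f) =
      (bruhat n (l.map fun i => a i ^ m i).prod).unop (expansion n f) := by
  induction l generalizing f with
  | nil => simp
  | cons i l ih =>
    obtain ⟨p, hp, hap⟩ := ha i (by simp)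
    -- Operators act from left to right, so the first variable has to be multiplied onto `f` first;
    -- polynomial multiplication allows this reordering.
    rw [List.map_cons, List.prod_cons, List.map_cons, List.prod_cons, mul_comm (X i ^ m i),
      mul_assoc, ih fun j hj => ha j (by simp [hj]), map_mul (bruhat n), unop_mul,
      Module.End.mul_apply, hap, ← hp, expansion_X_pow_mul]

theorem list_sort_prod {R : Type*} [CommMonoid R] (s : Finset ℕ) (g : ℕ → R) :
    ((s.sort (· ≤ ·)).map g).prod = ∏ i ∈ s, g i := by
  rw [← Multiset.prod_coe, ← Multiset.map_coe, Finset.sort_eq]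
  rfl

/-- Each ordered monomial in the `κ_p` acts on expansions as multiplication by the corresponding
monomial, so no commutativity inside `ℰ_n` is needed. The bound on the variables excludes those that
`evalKappa` sends to `0`. -/
theorem bruhat_evalKappa {f : MvPolynomial ℕ ℤ} (hf : ∀ i ∈ f.vars, i + 1 < n)
    (g : MvPolynomial ℕ ℤ) :
    (bruhat n (evalKappa n f)).unop (expansion n g) = expansion n (f * g) := by
  conv_rhs => rw [f.as_sum, Finset.sum_mul, map_sum]
  rw [evalKappa, evalAt, map_sum, Finset.unop_sum, LinearMap.sum_apply]
  refine Finset.sum_congr rfl fun m hm => ?_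
  rw [map_smul, unop_smul, LinearMap.smul_apply, ← expansion_list_prod_mul, list_sort_prod,
    ← map_smul, monomial_eq, ← smul_eq_C_mul, smul_mul_assoc]
  · rfl
  · intro i hi
    have hin : i + 1 < n :=
      hf i ((mem_vars_iff_mem_support i).mpr ⟨m, hm, (Finset.mem_sort _).mp hi⟩)
    exact ⟨⟨i, by omega⟩, rfl, dif_pos hin⟩

theorem bruhatAct_evalKappa_grothendieck (u v : Equiv.Perm (Fin n)) :
    bruhatAct (evalKappa n (grothendieck (toSInf u))) v =
      expansion n (grothendieck (toSInf u) * grothendieck (toSInf v)) := by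
  rw [bruhatAct, ← expansion_grothendieck, bruhat_evalKappa]
  exact fun i => lt_of_mem_vars_grothendieck (toSInf_fixed u)

end KFlag

theorem corollary3p1 (n : ℕ) (u v : Equiv.Perm (Fin n)) :
    (∃! c : KFlag.SInf →₀ ℤ,
      KFlag.IsStructureConstants (KFlag.toSInf u) (KFlag.toSInf v) c) ∧
    ∀ c : KFlag.SInf →₀ ℤ, KFlag.IsStructureConstants (KFlag.toSInf u) (KFlag.toSInf v) c →
      ∀ w : Equiv.Perm (Fin n), KFlag.length u + KFlag.length v ≤ KFlag.length w →
        c (KFlag.toSInf w) =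
          KFlag.bruhatAct (KFlag.evalKappa n (KFlag.grothendieck (KFlag.toSInf u))) v w := by
  refine ⟨⟨_, KFlag.isStructureConstants_iff.mpr rfl,
    fun c hc => KFlag.isStructureConstants_iff.mp hc⟩, fun c hc w _ => ?_⟩
  rw [KFlag.bruhatAct_evalKappa_grothendieck, KFlag.isStructureConstants_iff.mp hc]
  rfl
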